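/- Let $I\subseteq\mathbb R$ be a non-empty open interval (bounded or not), let $\rho,\eta:I\to(0,\infty)$ be smooth, and let $M^2=I\times\mathbb R$ carry the warped product metric $\rho(t)^2\,dt^2+\eta(t)^2\,dx^2$. Let $\mathbb R^N_a$ denote $\mathbb R^N$ with the inner product $\langle x,y\rangle=-\sum_{i\le a}x_iy_i+\sum_{i>a}x_iy_i$. For $c>0$ put $\mathbb S^N_a(c)=\{x\in\mathbb R^{N+1}_a:\langle x,x\rangle=1/c\}$ and $\mathbb H^N_a(-c)=\{x\in\mathbb R^{N+1}_{a+1}:\langle x,x\rangle=-1/c\}$, with the induced metrics. Here $\mathbb S^N(c)=\mathbb S^N_0(c)$ is the round sphere, $\mathbb H^N(-c)=\{x\in\mathbb H^N_0(-c):x_1>0\}$ is the hyperbolic space, $dS^N(c)=\mathbb S^N_1(c)$ (which is simply connected for $N\ge3$) is the de Sitter space, and the anti-de Sitter space $AdS^N(-c)$ is the semi-Riemannian universal covering of $\mathbb H^N_1(-c)$. An isometric embedding is an isometric immersion that is a homeomorphism onto its image. Then for every $c>0$: (i) $M^2$ admits non-injective smooth isometric immersions into $\mathbb R^5$, $\mathbb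 H^5(-c)$ and $\mathbb S^5(c)$. It also admits a smooth isometric immersion into $dS^3(c)$, and a non-injective one if $\inf_I\eta>0$. (ii) $M^2$ admits smooth isometric embeddings into $\mathbb R^9$, $\mathbb H^9(-c)$, $\mathbb S^{11}(c)$, $\mathbb R^3_1$, $\mathbb H^4_1(-c)$, $AdS^4(-c)$ and $dS^5(c)$. -/

import Mathlib

open scoped ContDiff

namespace WarpedSurface

/-- The inner product `-x₀y₀ - … - x_{a-1}y_{a-1} + x_a y_a + … + x_{n-1}y_{n-1}` of the
semi-Euclidean space `ℝⁿ_a`. -/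
def semiInner {n : ℕ} (a : ℕ) (x y : Fin n → ℝ) : ℝ :=
  ∑ i : Fin n, if (i : ℕ) < a then -(x i * y i) else x i * y i

/-- The quadric `𝕊ⁿ_a(c) = {x ∈ ℝⁿ⁺¹_a | ⟨x, x⟩ = 1 / c}`. -/
def pseudoSphere (n a : ℕ) (c : ℝ) : Set (Fin (n + 1) → ℝ) :=
  {x | semiInner a x x = 1 / c}

/-- The quadric `ℍⁿ_a(-c) = {x ∈ ℝⁿ⁺¹_{a+1} | ⟨x, x⟩ = -1 / c}`. -/
def pseudoHyperbolic (n a : ℕ) (c : ℝ) : Set (Fin (n + 1) → ℝ) :=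
  {x | semiInner (a + 1) x x = -(1 / c)}

/-- The round sphere `𝕊ⁿ(c)` of curvature `c` in `ℝⁿ⁺¹`. -/
def sphere (n : ℕ) (c : ℝ) : Set (Fin (n + 1) → ℝ) := pseudoSphere n 0 c

/-- The hyperbolic space `ℍⁿ(-c)` of curvature `-c`: the upper sheet of the quadric `ℍⁿ_0(-c)`. -/
def hyperbolicSpace (n : ℕ) (c : ℝ) : Set (Fin (n + 1) → ℝ) :=
  {x | x ∈ pseudoHyperbolic n 0 c ∧ 0 < x 0}

/-- De Sitter space `dSⁿ(c)`, as the quadric `𝕊ⁿ_1(c)` in `ℝⁿ⁺¹_1`. For `n ≥ 3` this quadric is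
diffeomorphic to `ℝ × 𝕊ⁿ⁻¹`, hence simply connected and its own universal covering. -/
def deSitter (n : ℕ) (c : ℝ) : Set (Fin (n + 1) → ℝ) := pseudoSphere n 1 c

/-- The universal covering map `ℝ × ℝᵐ → ℍ^{m+1}_1(-c) ⊆ ℝ^{m+2}_2`,
`(τ, y) ↦ (r cos τ, r sin τ, y)` with `r = √(1 / c + |y|²)`. -/
noncomputable def adsCover (m : ℕ) (c : ℝ) (z : ℝ × (Fin m → ℝ)) : Fin (m + 2) → ℝ :=
  Matrix.vecCons (√(1 / c + ∑ i, z.2 i ^ 2) * Real.cos z.1)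
    (Matrix.vecCons (√(1 / c + ∑ i, z.2 i ^ 2) * Real.sin z.1) z.2)

/-- The metric of the anti-de Sitter space `AdS^{m+1}(-c)`, the semi-Riemannian universal covering
of `ℍ^{m+1}_1(-c)`, on its underlying manifold `ℝ × ℝᵐ`: the pull-back of the metric of the quadric
under the covering map. -/
noncomputable def adsMetric (m : ℕ) (c : ℝ) (z v w : ℝ × (Fin m → ℝ)) : ℝ :=
  semiInner 2 (fderiv ℝ (adsCover m c) z v) (fderiv ℝ (adsCover m c) z w)

/-- `f` restricts to a smooth isometric immersion of `I × ℝ`, with the warped product metric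
`ρ(t)² dt² + η(t)² dx²`, into the submanifold `S` of `E` with the metric induced from the (possibly
indefinite) metric `G` of `E`; here `G z v w` is the product of `v` and `w` at the point `z`.
As the pulled back metric is positive definite, the differential of `f` is injective on `I × ℝ`. -/
structure IsIsometricImmersion {E : Type*} [NormedAddCommGroup E] [NormedSpace ℝ E]
    (I : Set ℝ) (ρ η : ℝ → ℝ) (G : E → E → E → ℝ) (S : Set E) (f : ℝ × ℝ → E) : Prop where
  smooth : ContDiffOn ℝ ∞ f (I ×ˢ Set.univ)
  mapsTo : Set.MapsTo f (I ×ˢ Set.univ) S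
  isometric : ∀ p ∈ I ×ˢ (Set.univ : Set ℝ), ∀ v w : ℝ × ℝ,
    G (f p) (fderiv ℝ f p v) (fderiv ℝ f p w) =
      ρ p.1 ^ 2 * (v.1 * w.1) + η p.1 ^ 2 * (v.2 * w.2)

/-- A smooth isometric immersion of `I × ℝ` that is a homeomorphism onto its image. -/
structure IsIsometricEmbedding {E : Type*} [NormedAddCommGroup E] [NormedSpace ℝ E]
    (I : Set ℝ) (ρ η : ℝ → ℝ) (G : E → E → E → ℝ) (S : Set E) (f : ℝ × ℝ → E) : Prop
    extends IsIsometricImmersion I ρ η G S f where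
  isEmbedding : Topology.IsEmbedding ((I ×ˢ Set.univ).domRestrict f)

/-- `I × ℝ` has a smooth isometric immersion into the submanifold `S` of `ℝᴺ_a`. -/
def Immerses (I : Set ℝ) (ρ η : ℝ → ℝ) {N : ℕ} (a : ℕ) (S : Set (Fin N → ℝ)) : Prop :=
  ∃ f : ℝ × ℝ → Fin N → ℝ, IsIsometricImmersion I ρ η (fun _ => semiInner a) S f

/-- `I × ℝ` has a non-injective smooth isometric immersion into the submanifold `S` of `ℝᴺ_a`. -/
def ImmersesNonInjectively (I : Set ℝ) (ρ η : ℝ → ℝ) {N : ℕ} (a : ℕ)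
    (S : Set (Fin N → ℝ)) : Prop :=
  ∃ f : ℝ × ℝ → Fin N → ℝ, IsIsometricImmersion I ρ η (fun _ => semiInner a) S f ∧
    ¬ Set.InjOn f (I ×ˢ Set.univ)

/-- `I × ℝ` has a smooth isometric embedding into the submanifold `S` of `ℝᴺ_a`. -/
def Embeds (I : Set ℝ) (ρ η : ℝ → ℝ) {N : ℕ} (a : ℕ) (S : Set (Fin N → ℝ)) : Prop :=
  ∃ f : ℝ × ℝ → Fin N → ℝ, IsIsometricEmbedding I ρ η (fun _ => semiInner a) S f

/-- `I × ℝ` has a smooth isometric embedding into `AdS^{m+1}(-c)`. -/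
def EmbedsInAdS (I : Set ℝ) (ρ η : ℝ → ℝ) (m : ℕ) (c : ℝ) : Prop :=
  ∃ F : ℝ × ℝ → ℝ × (Fin m → ℝ), IsIsometricEmbedding I ρ η (adsMetric m c) Set.univ F

end WarpedSurface

/-!
Outside the anti-de Sitter case, the maps below have the form `(t, x) ↦ (A(t), Y(t, x))` up to the
order of the blocks, where `Y` induces `e(t) dt² + η² dx²` and `⟨Y, Y⟩ = q(t)`. The missing part `(ρ² - e) dt²` is supplied by the
curve `A`. For a flat target `A` is one coordinate, a primitive of `√(ρ² - e)`. For a quadric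
`⟨x, x⟩ = K` it is `A = r γ` with `γ` in the quadric `⟨γ, γ⟩ = ε`, `ε = ±1`, in the complementary
coordinates; then `r` is forced by `ε r² = K - q`, and the speed of `γ` exists as soon as
`q'² / (4 (K - q)) + e < ρ²` (`exists_radius_speed`).

The blocks `Y` are built from `b(t) γ(N x)` with `γ` a curve of unit speed in a circle, in `𝕊³` or
in a hyperbola, inducing `± b'² dt² + b² N² dx²`. In a Lorentzian target the choice
`Y = η(t) (cosh x, sinh x)` has `e = -η'²` and leaves room for `A`. In a Riemannian target `e` must
be small, and following Blanuša and Rozendorn `η` is split as `η² = (b₀ N₀)² + (b₁ N₁)²` with integer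
step functions `N₀`, `N₁` so large on each compact piece of `I` that the amplitudes `b₀`, `b₁` and
their derivatives are as small as required. The jumps of `Nᵢ` are placed where `bᵢ` vanishes
identically, which keeps the map smooth (`exists_isAmplitudePair`, `hasMetric_spin`).

With circles for `γ` the maps are periodic in `x`, so not injective. Embeddings result from
replacing circles by spirals, embedded curves of arbitrary speed in the compact `𝕊³`
(`exists_spiral`): the parameter `t` depends continuously on the point through `A`, and, since some
`bᵢ(t)` is nonzero and its `Nᵢ` locally constant, so does `x`.

Finally `ℝ³_1` is isometric to the horosphere `x₀ + x₄ = 1` of `ℍ⁴_1(-c)`. On it `(x₀, x₁)` avoids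
the negative real axis, so the principal argument lifts it to the universal covering.
-/

namespace WarpedSurface

open Filter Topology

/-! ### Linear algebra of the semi-Euclidean product -/

section SemiInner

variable {n k m : ℕ} (a : ℕ)

theorem semiInner_comm (x y : Fin n → ℝ) : semiInner a x y = semiInner a y x := by
  simp only [semiInner, mul_comm]

theorem semiInner_add_left (x y z : Fin n → ℝ) :
    semiInner a (x + y) z = semiInner a x z + semiInner a y z := by
  simp only [semiInner, ← Finset.sum_add_distrib]
  refine Finset.sum_congr rfl fun i _ => ?_
  split_ifs <;> simp only [Pi.add_apply] <;> ring

theorem semiInner_smul_left (r : ℝ) (x y : Fin n → ℝ) :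
    semiInner a (r • x) y = r * semiInner a x y := by
  simp only [semiInner, Finset.mul_sum]
  refine Finset.sum_congr rfl fun i _ => ?_
  split_ifs <;> simp only [Pi.smul_apply, smul_eq_mul] <;> ring

theorem semiInner_add_right (x y z : Fin n → ℝ) :
    semiInner a x (y + z) = semiInner a x y + semiInner a x z := by
  simp only [semiInner_comm a x, semiInner_add_left]

theorem semiInner_smul_right (r : ℝ) (x y : Fin n → ℝ) :
    semiInner a x (r • y) = r * semiInner a x y := by
  simp only [semiInner_comm a x, semiInner_smul_left]

/-- When the negative coordinates all lie in the first block, the semi-Euclidean product splits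
orthogonally. -/
theorem semiInner_append (h : a ≤ k) (x x' : Fin k → ℝ) (y y' : Fin m → ℝ) :
    semiInner a (Fin.append x y) (Fin.append x' y') = semiInner a x x' + semiInner 0 y y' := by
  have h' (j : Fin m) : ¬ k + (j : ℕ) < a := by omega
  simp [semiInner, Fin.sum_univ_add, h']

theorem continuous_semiInner_self : Continuous fun x : Fin n → ℝ => semiInner a x x := by
  unfold semiInner
  refine continuous_finsetSum _ fun i _ => ?_
  split_ifs <;> fun_prop

theorem hasDerivAt_semiInner {γ δ : ℝ → Fin n → ℝ} {γ' δ' : Fin n → ℝ} {t : ℝ}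
    (hγ : HasDerivAt γ γ' t) (hδ : HasDerivAt δ δ' t) :
    HasDerivAt (fun s => semiInner a (γ s) (δ s))
      (semiInner a γ' (δ t) + semiInner a (γ t) δ') t := by
  simp only [WarpedSurface.semiInner, ← Finset.sum_add_distrib]
  refine HasDerivAt.fun_sum fun i _ => ?_
  have := (hasDerivAt_pi.1 hγ i).fun_mul (hasDerivAt_pi.1 hδ i)
  split_ifs
  · simpa only [neg_add] using this.fun_neg
  · exact this

end SemiInner

/-! ### Homeomorphisms onto the image, on a subset -/

/-- `f` restricted to `s` is injective with continuous inverse `f '' s → s`, see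
`EmbedsOn.isEmbedding`. -/
def EmbedsOn {X Y : Type*} [TopologicalSpace X] [TopologicalSpace Y] (f : X → Y) (s : Set X) :
    Prop :=
  ∀ p ∈ s, comap f (𝓝 (f p)) ⊓ 𝓟 s ≤ 𝓝 p

section EmbedsOn

variable {X Y Z : Type*} [TopologicalSpace X] [TopologicalSpace Y] [TopologicalSpace Z]
  {f : X → Y} {s : Set X}

theorem EmbedsOn.isEmbedding [T1Space X] (h : EmbedsOn f s) (hf : ContinuousOn f s) :
    IsEmbedding (s.domRestrict f) := by
  constructor
  · rw [isInducing_iff_nhds]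
    intro p
    refine le_antisymm hf.domRestrict.continuousAt.tendsto.le_comap ?_
    rw [nhds_subtype_eq_comap, ← map_le_iff_le_comap]
    refine le_trans (le_inf ?_ ?_) (h p p.2)
    · rw [← map_le_iff_le_comap, map_map]
      exact map_comap_le
    · exact tendsto_principal.2 (Eventually.of_forall fun q => q.2)
  · -- If `f p = f q`, the principal filter of `p` converges to `q`.
    intro p q hpq
    have : pure (p : X) ≤ 𝓝 (q : X) := by
      refine le_trans (le_inf ?_ ?_) (h q q.2)
      · rw [← map_le_iff_le_comap, map_pure]
        change f p = f q at hpq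
        rw [hpq]
        exact pure_le_nhds _
      · simp
    exact Subtype.ext (pure_le_nhds_iff.1 this)

theorem EmbedsOn.tendsto (h : EmbedsOn f s) {ι : Type*} {l : Filter ι} {u : ι → X} {p : X}
    (hp : p ∈ s) (hu : ∀ᶠ i in l, u i ∈ s) (hl : Tendsto (fun i => f (u i)) l (𝓝 (f p))) :
    Tendsto u l (𝓝 p) := by
  refine le_trans (le_inf ?_ ?_) (h p hp)
  · exact map_le_iff_le_comap.1 (by rwa [map_map])
  · exact tendsto_principal.2 hu

theorem EmbedsOn.of_comp {g : Y → Z} (hg : Continuous g) (h : EmbedsOn (fun x => g (f x)) s) :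
    EmbedsOn f s := by
  intro p hp
  refine le_trans (inf_le_inf_right _ ?_) (h p hp)
  rw [← map_le_iff_le_comap]
  exact (hg.tendsto (f p)).comp tendsto_comap

/-- A strictly increasing function on an open set separates nearby points by its values; no
continuity is needed. -/
theorem embedsOn_of_strictMonoOn {I : Set ℝ} (hI : IsOpen I) {φ : ℝ → ℝ}
    (hφ : StrictMonoOn φ I) : EmbedsOn φ I := by
  intro t ht
  rw [(nhds_basis_Ioo t).ge_iff]
  rintro ⟨a, b⟩ ⟨ha, hb⟩
  dsimp only at ha hb ⊢
  obtain ⟨l, u, hlu, hsub⟩ := mem_nhds_iff_exists_Ioo_subset.1 (hI.mem_nhds ht)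
  obtain ⟨l', hl1, hl2⟩ := exists_between (max_lt ha hlu.1)
  obtain ⟨u', hu1, hu2⟩ := exists_between (lt_min hb hlu.2)
  rw [max_lt_iff] at hl1
  rw [lt_min_iff] at hu2
  have hl : l' ∈ I := hsub ⟨hl1.2, hl2.trans hlu.2⟩
  have hu : u' ∈ I := hsub ⟨hlu.1.trans hu1, hu2.2⟩
  have hmem : Set.Ioo (φ l') (φ u') ∈ 𝓝 (φ t) := Ioo_mem_nhds (hφ hl ht hl2) (hφ ht hu hu1)
  filter_upwards [mem_inf_of_left (preimage_mem_comap hmem),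
    mem_inf_of_right (mem_principal_self I)] with x hx hxI
  exact ⟨hl1.1.trans ((hφ.lt_iff_lt hl hxI).1 hx.1), ((hφ.lt_iff_lt hxI hu).1 hx.2).trans hu2.1⟩

end EmbedsOn

/-! ### Maps with a diagonal pulled-back metric -/

/-- On `I × ℝ` the map `f` is smooth and pulls the product of `ℝⁿ_a` back to
`g(t) dt² + h(t) dx²`; the coefficients may have any sign. -/
structure HasMetric (I : Set ℝ) (a : ℕ) {n : ℕ} (f : ℝ × ℝ → Fin n → ℝ) (g h : ℝ → ℝ) : Prop where
  smooth : ContDiffOn ℝ ∞ f (I ×ˢ Set.univ)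
  metric : ∀ p ∈ I ×ˢ (Set.univ : Set ℝ), ∀ v w : ℝ × ℝ,
    semiInner a (fderiv ℝ f p v) (fderiv ℝ f p w) = g p.1 * (v.1 * w.1) + h p.1 * (v.2 * w.2)

theorem isOpen_strip {I : Set ℝ} (hI : IsOpen I) : IsOpen (I ×ˢ (Set.univ : Set ℝ)) :=
  hI.prod isOpen_univ

theorem contDiffOn_finAppend {E : Type*} [NormedAddCommGroup E] [NormedSpace ℝ E] {s : Set E}
    {k m : ℕ} {f : E → Fin k → ℝ} {g : E → Fin m → ℝ} (hf : ContDiffOn ℝ ∞ f s)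
    (hg : ContDiffOn ℝ ∞ g s) : ContDiffOn ℝ ∞ (fun p => Fin.append (f p) (g p)) s := by
  rw [contDiffOn_pi] at *
  intro i
  refine Fin.addCases (fun j => ?_) (fun j => ?_) i
  · simpa using hf j
  · simpa using hg j

theorem fderiv_finAppend {E : Type*} [NormedAddCommGroup E] [NormedSpace ℝ E]
    {k m : ℕ} {f : E → Fin k → ℝ} {g : E → Fin m → ℝ} {p : E} (hf : DifferentiableAt ℝ f p)
    (hg : DifferentiableAt ℝ g p) (v : E) :
    fderiv ℝ (fun p => Fin.append (f p) (g p)) p v =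
      Fin.append (fderiv ℝ f p v) (fderiv ℝ g p v) := by
  have hfi := hasFDerivAt_pi'.1 hf.hasFDerivAt
  have hgi := hasFDerivAt_pi'.1 hg.hasFDerivAt
  have h : DifferentiableAt ℝ (fun p => Fin.append (f p) (g p)) p := by
    rw [differentiableAt_pi]
    intro i
    refine Fin.addCases (fun j => ?_) (fun j => ?_) i
    · simpa using (hfi j).differentiableAt
    · simpa using (hgi j).differentiableAt
  have hi := hasFDerivAt_pi'.1 h.hasFDerivAt
  ext i
  refine Fin.addCases (fun j => ?_) (fun j => ?_) i
  · have h1 := hi (Fin.castAdd m j)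
    simp only [Fin.append_left] at h1 ⊢
    exact congrArg (· v) (h1.unique (hfi j))
  · have h1 := hi (Fin.natAdd k j)
    simp only [Fin.append_right] at h1 ⊢
    exact congrArg (· v) (h1.unique (hgi j))

theorem HasMetric.append {I : Set ℝ} (hI : IsOpen I) {a k m : ℕ} (hak : a ≤ k)
    {f : ℝ × ℝ → Fin k → ℝ} {g : ℝ × ℝ → Fin m → ℝ} {e e' h h' : ℝ → ℝ}
    (hf : HasMetric I a f e h) (hg : HasMetric I 0 g e' h') :
    HasMetric I a (fun p => Fin.append (f p) (g p)) (fun t => e t + e' t)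
      (fun t => h t + h' t) := by
  refine ⟨contDiffOn_finAppend hf.smooth hg.smooth, fun p hp v w => ?_⟩
  have hn := (isOpen_strip hI).mem_nhds hp
  rw [fderiv_finAppend, fderiv_finAppend, semiInner_append a hak, hf.metric p hp, hg.metric p hp]
  · ring
  all_goals
    first
    | exact (hf.smooth.contDiffAt hn).differentiableAt (by simp)
    | exact (hg.smooth.contDiffAt hn).differentiableAt (by simp)

/-- A curve, seen as a map of `(t, x)` independent of `x`. -/
theorem HasMetric.of_curve {I : Set ℝ} (hI : IsOpen I) {a k : ℕ} {A : ℝ → Fin k → ℝ} {e : ℝ → ℝ}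
    (hA : ContDiffOn ℝ ∞ A I) (he : ∀ t ∈ I, semiInner a (deriv A t) (deriv A t) = e t) :
    HasMetric I a (fun p => A p.1) e (fun _ => 0) := by
  refine ⟨hA.comp contDiffOn_fst fun p hp => hp.1, fun p hp v w => ?_⟩
  have h1 : HasDerivAt A (deriv A p.1) p.1 :=
    ((hA.contDiffAt (hI.mem_nhds hp.1)).differentiableAt (by simp)).hasDerivAt
  have h2 : HasFDerivAt (fun p : ℝ × ℝ => A p.1) _ p := h1.hasFDerivAt.comp p hasFDerivAt_fst
  rw [h2.fderiv]
  simp [semiInner_smul_left, semiInner_smul_right, he _ hp.1]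
  ring

/-! ### Curves in quadrics -/

/-- On `I` the curve `γ` is smooth, lies in the quadric `⟨x, x⟩ = ε` of `ℝᵏ_a` and has
`⟨γ', γ'⟩ = w²`. -/
structure IsQuadricCurve (I : Set ℝ) (a : ℕ) {k : ℕ} (ε : ℝ) (w : ℝ → ℝ)
    (γ : ℝ → Fin k → ℝ) : Prop where
  smooth : ContDiffOn ℝ ∞ γ I
  norm : ∀ t ∈ I, semiInner a (γ t) (γ t) = ε
  speed : ∀ t ∈ I, semiInner a (deriv γ t) (deriv γ t) = w t ^ 2

section IsQuadricCurve

variable {I : Set ℝ} {a k : ℕ} {ε : ℝ} {w : ℝ → ℝ} {γ : ℝ → Fin k → ℝ}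

theorem IsQuadricCurve.hasDerivAt (h : IsQuadricCurve I a ε w γ) (hI : IsOpen I) {t : ℝ}
    (ht : t ∈ I) : HasDerivAt γ (deriv γ t) t :=
  ((h.smooth.contDiffAt (hI.mem_nhds ht)).differentiableAt (by simp)).hasDerivAt

theorem IsQuadricCurve.orthogonal (h : IsQuadricCurve I a ε w γ) (hI : IsOpen I) {t : ℝ}
    (ht : t ∈ I) : semiInner a (γ t) (deriv γ t) = 0 := by
  have h1 := hasDerivAt_semiInner a (h.hasDerivAt hI ht) (h.hasDerivAt hI ht)
  have h2 : HasDerivAt (fun s => semiInner a (γ s) (γ s)) 0 t :=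
    (hasDerivAt_const t ε).congr_of_eventuallyEq <| by
      filter_upwards [hI.mem_nhds ht] with s hs using h.norm s hs
  have h3 := h1.unique h2
  rw [semiInner_comm] at h3
  linarith

/-- `⟨(rγ)', (rγ)'⟩ = ε r'² + r² w²`. -/
theorem IsQuadricCurve.semiInner_deriv_smul (h : IsQuadricCurve I a ε w γ) (hI : IsOpen I)
    {r : ℝ → ℝ} (hr : ContDiffOn ℝ ∞ r I) {t : ℝ} (ht : t ∈ I) :
    semiInner a (deriv (fun s => r s • γ s) t) (deriv (fun s => r s • γ s) t) =
      ε * deriv r t ^ 2 + r t ^ 2 * w t ^ 2 := by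
  have h1 : HasDerivAt r (deriv r t) t :=
    ((hr.contDiffAt (hI.mem_nhds ht)).differentiableAt (by simp)).hasDerivAt
  have h2 : HasDerivAt (fun s => r s • γ s) _ t := h1.smul (h.hasDerivAt hI ht)
  rw [h2.deriv]
  simp only [semiInner_add_left, semiInner_add_right, semiInner_smul_left, semiInner_smul_right,
    semiInner_comm a (deriv γ t) (γ t), h.orthogonal hI ht, h.norm t ht, h.speed t ht]
  ring

end IsQuadricCurve

/-- A smooth function on an open interval has a smooth primitive. -/
theorem exists_primitive {I : Set ℝ} (hI : IsOpen I) (hI' : I.OrdConnected) (hne : I.Nonempty)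
    {w : ℝ → ℝ} (hw : ContDiffOn ℝ ∞ w I) :
    ∃ W : ℝ → ℝ, ContDiffOn ℝ ∞ W I ∧ ∀ t ∈ I, HasDerivAt W (w t) t := by
  obtain ⟨t₀, h₀⟩ := hne
  have hd : ∀ t ∈ I, HasDerivAt (fun u => ∫ s in t₀..u, w s) (w t) t := fun t ht =>
    intervalIntegral.integral_hasDerivAt_right
      ((hw.continuousOn.mono (hI'.uIcc_subset h₀ ht)).intervalIntegrable)
      (hw.continuousOn.stronglyMeasurableAtFilter hI t ht)
      (hw.continuousOn.continuousAt (hI.mem_nhds ht))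
  refine ⟨_, ?_, hd⟩
  refine (contDiffOn_infty_iff_deriv_of_isOpen hI).2
    ⟨fun t ht => (hd t ht).differentiableAt.differentiableWithinAt, ?_⟩
  exact hw.congr fun t ht => (hd t ht).deriv

theorem strictMonoOn_of_hasDerivAt_pos {I : Set ℝ} (hI : IsOpen I) (hI' : I.OrdConnected)
    {W w : ℝ → ℝ} (h : ∀ t ∈ I, HasDerivAt W (w t) t) (hw : ∀ t ∈ I, 0 < w t) :
    StrictMonoOn W I := by
  refine strictMonoOn_of_deriv_pos hI'.convex
    (fun t ht => (h t ht).continuousAt.continuousWithinAt) fun t ht => ?_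
  rw [hI.interior_eq] at ht
  rw [(h t ht).deriv]
  exact hw t ht

theorem hasDerivAt_vecCons {n : ℕ} {f : ℝ → ℝ} {g : ℝ → Fin n → ℝ} {f' : ℝ} {g' : Fin n → ℝ}
    {t : ℝ} (hf : HasDerivAt f f' t) (hg : HasDerivAt g g' t) :
    HasDerivAt (fun s => Matrix.vecCons (f s) (g s)) (Matrix.vecCons f' g') t := by
  rw [hasDerivAt_pi] at *
  intro i
  refine Fin.cases ?_ (fun j => ?_) i
  · simpa using hf
  · simpa using hg j

theorem hasDerivAt_vecEmpty {t : ℝ} :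
    HasDerivAt (fun _ => ![] : ℝ → Fin 0 → ℝ) ![] t :=
  hasDerivAt_pi.2 fun i => i.elim0

theorem contDiffOn_vecCons {E : Type*} [NormedAddCommGroup E] [NormedSpace ℝ E] {s : Set E}
    {n : ℕ} {f : E → ℝ} {g : E → Fin n → ℝ} (hf : ContDiffOn ℝ ∞ f s) (hg : ContDiffOn ℝ ∞ g s) :
    ContDiffOn ℝ ∞ (fun p => Matrix.vecCons (f p) (g p)) s := by
  rw [contDiffOn_pi] at *
  intro i
  refine Fin.cases ?_ (fun j => ?_) i
  · simpa using hf
  · simpa using hg j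

theorem contDiffOn_vecEmpty {E : Type*} [NormedAddCommGroup E] [NormedSpace ℝ E] {s : Set E} :
    ContDiffOn ℝ ∞ (fun _ => ![] : E → Fin 0 → ℝ) s :=
  contDiffOn_pi.2 fun i => i.elim0

section Curves

variable {I : Set ℝ} {θ w : ℝ → ℝ}

theorem isQuadricCurve_circle (hθ : ContDiffOn ℝ ∞ θ I) (hd : ∀ t ∈ I, HasDerivAt θ (w t) t) :
    IsQuadricCurve I 0 1 w fun t => ![Real.cos (θ t), Real.sin (θ t)] := by
  refine ⟨?_, fun t ht => ?_, fun t ht => ?_⟩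
  · exact contDiffOn_vecCons hθ.cos (contDiffOn_vecCons hθ.sin contDiffOn_vecEmpty)
  · simp [semiInner, Fin.sum_univ_succ]
    linear_combination Real.sin_sq_add_cos_sq (θ t)
  · have h : HasDerivAt (fun t => ![Real.cos (θ t), Real.sin (θ t)]) _ t :=
      hasDerivAt_vecCons (hd t ht).cos (hasDerivAt_vecCons (hd t ht).sin hasDerivAt_vecEmpty)
    rw [h.deriv]
    simp [semiInner, Fin.sum_univ_succ]
    linear_combination w t ^ 2 * Real.sin_sq_add_cos_sq (θ t)

theorem isQuadricCurve_hyperbola (hθ : ContDiffOn ℝ ∞ θ I)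
    (hd : ∀ t ∈ I, HasDerivAt θ (w t) t) :
    IsQuadricCurve I 1 (-1) w fun t => ![Real.cosh (θ t), Real.sinh (θ t)] := by
  refine ⟨?_, fun t ht => ?_, fun t ht => ?_⟩
  · exact contDiffOn_vecCons hθ.cosh (contDiffOn_vecCons hθ.sinh contDiffOn_vecEmpty)
  · simp [semiInner, Fin.sum_univ_succ]
    linear_combination -Real.cosh_sq_sub_sinh_sq (θ t)
  · have h : HasDerivAt (fun t => ![Real.cosh (θ t), Real.sinh (θ t)]) _ t :=
      hasDerivAt_vecCons (hd t ht).cosh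
        (hasDerivAt_vecCons (hd t ht).sinh hasDerivAt_vecEmpty)
    rw [h.deriv]
    simp [semiInner, Fin.sum_univ_succ]
    linear_combination w t ^ 2 * Real.cosh_sq_sub_sinh_sq (θ t)

theorem embedsOn_hyperbola (hI : IsOpen I) (hθ : StrictMonoOn θ I) :
    EmbedsOn (fun t => ![Real.cosh (θ t), Real.sinh (θ t)]) I := by
  refine EmbedsOn.of_comp (continuous_apply 1) ?_
  exact embedsOn_of_strictMonoOn hI fun s hs t ht hst => Real.sinh_lt_sinh.2 (hθ hs ht hst)

/-- On an open interval there are embedded curves of prescribed speed, possibly of infinite length,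
in the compact sphere `𝕊³`: spirals whose latitude increases strictly while staying below `π / 4`
in absolute value. -/
theorem exists_spiral (hI : IsOpen I) (hI' : I.OrdConnected) (hne : I.Nonempty)
    (hw : ContDiffOn ℝ ∞ w I) (hpos : ∀ t ∈ I, 0 < w t) :
    ∃ γ : ℝ → Fin 4 → ℝ, IsQuadricCurve I 0 1 w γ ∧ EmbedsOn γ I := by
  obtain ⟨σ, hσ, hσd⟩ := exists_primitive hI hI' hne hw
  have hσm := strictMonoOn_of_hasDerivAt_pos hI hI' hσd hpos
  -- The latitude is a bounded increasing function of the arc length `σ`; its derivative `ν` is at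
  -- most `w / 2`, so the longitude `θ` can make up for the rest of the speed.
  set φ : ℝ → ℝ := fun t => Real.arctan (σ t) / 2 with hφ
  set ν : ℝ → ℝ := fun t => w t / (2 * (1 + σ t ^ 2)) with hν
  have hφs : ContDiffOn ℝ ∞ φ I := hσ.arctan.div_const 2
  have hφd : ∀ t ∈ I, HasDerivAt φ (ν t) t := fun t ht => by
    refine ((hσd t ht).arctan.div_const 2).congr_deriv ?_
    simp only [hν]
    field_simp
  have hq : ∀ t, -(Real.pi / 4) < φ t ∧ φ t < Real.pi / 4 := fun t => by
    have h1 := Real.neg_pi_div_two_lt_arctan (σ t)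
    have h2 := Real.arctan_lt_pi_div_two (σ t)
    constructor <;> simp only [hφ] <;> linarith
  have hcos : ∀ t, 0 < Real.cos (φ t) := fun t =>
    Real.cos_pos_of_mem_Ioo ⟨by linarith [hq t, Real.pi_pos], by linarith [hq t, Real.pi_pos]⟩
  have hνw : ∀ t ∈ I, 0 < w t ^ 2 - ν t ^ 2 := fun t ht => by
    have h0 := hpos t ht
    have h1 : ν t < w t := by
      simp only [hν]
      rw [div_lt_iff₀ (by positivity)]
      nlinarith [mul_nonneg h0.le (sq_nonneg (σ t))]
    have h2 : 0 < ν t := by simp only [hν]; positivity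
    nlinarith
  have hνs : ContDiffOn ℝ ∞ ν I := by
    refine hw.div (contDiffOn_const.mul (contDiffOn_const.add (hσ.pow 2))) fun t _ => ?_
    positivity
  obtain ⟨θ, hθ, hθd⟩ := exists_primitive hI hI' hne
    (w := fun t => √(w t ^ 2 - ν t ^ 2) / Real.cos (φ t))
    ((((hw.pow 2).sub (hνs.pow 2)).sqrt fun t ht => (hνw t ht).ne').div hφs.cos
      fun t _ => (hcos t).ne')
  refine ⟨fun t => ![Real.cos (φ t) * Real.cos (θ t), Real.cos (φ t) * Real.sin (θ t),
    Real.sin (φ t), 0], ⟨?_, fun t ht => ?_, fun t ht => ?_⟩, ?_⟩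
  · exact contDiffOn_vecCons (hφs.cos.mul hθ.cos) (contDiffOn_vecCons (hφs.cos.mul hθ.sin)
      (contDiffOn_vecCons hφs.sin (contDiffOn_vecCons contDiffOn_const contDiffOn_vecEmpty)))
  · simp [semiInner, Fin.sum_univ_succ]
    linear_combination Real.cos (φ t) ^ 2 * Real.sin_sq_add_cos_sq (θ t) +
      Real.sin_sq_add_cos_sq (φ t)
  · have h : HasDerivAt (fun t => ![Real.cos (φ t) * Real.cos (θ t),
        Real.cos (φ t) * Real.sin (θ t), Real.sin (φ t), 0]) _ t :=
      hasDerivAt_vecCons ((hφd t ht).cos.fun_mul (hθd t ht).cos)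
        (hasDerivAt_vecCons ((hφd t ht).cos.fun_mul (hθd t ht).sin)
        (hasDerivAt_vecCons (hφd t ht).sin
        (hasDerivAt_vecCons (hasDerivAt_const t 0) hasDerivAt_vecEmpty)))
    rw [h.deriv]
    have h1 : Real.cos (φ t) * (√(w t ^ 2 - ν t ^ 2) / Real.cos (φ t)) = √(w t ^ 2 - ν t ^ 2) :=
      mul_div_cancel₀ _ (hcos t).ne'
    have h2 := Real.sq_sqrt (hνw t ht).le
    rw [← h1] at h2
    simp only [semiInner, Fin.sum_univ_succ]
    simp
    linear_combination h2 + (Real.cos (φ t) ^ 2 * (√(w t ^ 2 - ν t ^ 2) / Real.cos (φ t)) ^ 2 +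
      Real.sin (φ t) ^ 2 * ν t ^ 2) * Real.sin_sq_add_cos_sq (θ t) +
      ν t ^ 2 * Real.sin_sq_add_cos_sq (φ t)
  · refine EmbedsOn.of_comp (continuous_apply 2) ?_
    refine embedsOn_of_strictMonoOn hI fun s hs t ht hst => ?_
    refine Real.sin_lt_sin_of_lt_of_le_pi_div_two (by linarith [hq s, Real.pi_pos])
      (by linarith [hq t, Real.pi_pos]) ?_
    have := Real.arctan_strictMono (hσm hs ht hst)
    simp only [hφ]
    linarith

end Curves

/-! ### Maps `(t, x) ↦ b(t) γ(N(t) x)` with a step function `N` -/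

theorem HasMetric.congr {I : Set ℝ} {a n : ℕ} {f : ℝ × ℝ → Fin n → ℝ} {g h g' h' : ℝ → ℝ}
    (H : HasMetric I a f g h) (hg : ∀ t ∈ I, g t = g' t) (hh : ∀ t ∈ I, h t = h' t) :
    HasMetric I a f g' h' :=
  ⟨H.smooth, fun p hp v w => by rw [H.metric p hp, hg _ hp.1, hh _ hp.1]⟩

/-- Near points with parameter `t`, the function `N` is constant or the function `b` vanishes. -/
def ConstOffZeros (N b : ℝ → ℝ) (t : ℝ) : Prop :=
  (∀ᶠ s in 𝓝 t, N s = N t) ∨ ∀ᶠ s in 𝓝 t, b s = 0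

/-- The map `(t, x) ↦ b(t) γ(N(t) x)`. -/
def spin {k : ℕ} (b N : ℝ → ℝ) (γ : ℝ → Fin k → ℝ) (p : ℝ × ℝ) : Fin k → ℝ :=
  b p.1 • γ (N p.1 * p.2)

section Spin

variable {I : Set ℝ} {a k : ℕ} {ε : ℝ} {b N : ℝ → ℝ} {γ : ℝ → Fin k → ℝ}

theorem semiInner_spin (hγ : IsQuadricCurve Set.univ a ε 1 γ) (p : ℝ × ℝ) :
    semiInner a (spin b N γ p) (spin b N γ p) = ε * b p.1 ^ 2 := by
  simp only [spin, semiInner_smul_left, semiInner_smul_right, hγ.norm _ (Set.mem_univ _)]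
  ring

/-- If `N` is locally constant where `b` does not vanish identically, `N` may be treated as a
constant when differentiating `b(t) γ(N(t) x)`, and the map is smooth across the jumps of `N`. -/
theorem hasMetric_spin (hI : IsOpen I) (hγ : IsQuadricCurve Set.univ a ε 1 γ)
    (hb : ContDiffOn ℝ ∞ b I) (hN : ∀ t ∈ I, ConstOffZeros N b t) :
    HasMetric I a (spin b N γ) (fun t => ε * deriv b t ^ 2) (fun t => b t ^ 2 * N t ^ 2) := by
  have hsm : ContDiff ℝ ∞ γ := contDiffOn_univ.1 hγ.smooth
  -- Where `b` vanishes identically both sides of the derivative formula are zero.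
  have key : ∀ p ∈ I ×ˢ (Set.univ : Set ℝ), ∃ g : ℝ × ℝ → Fin k → ℝ, spin b N γ =ᶠ[𝓝 p] g ∧
      ContDiffAt ℝ ∞ g p ∧ ∀ v, fderiv ℝ g p v = (deriv b p.1 * v.1) • γ (N p.1 * p.2) +
        (b p.1 * N p.1 * v.2) • deriv γ (N p.1 * p.2) := by
    intro p hp
    have hbp := hb.contDiffAt (hI.mem_nhds hp.1)
    rcases hN p.1 hp.1 with h | h
    · refine ⟨fun z => b z.1 • γ (N p.1 * z.2), ?_, ?_, fun v => ?_⟩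
      · filter_upwards [continuousAt_fst.eventually h] with z hz
        simp only [spin, hz]
      · exact (hbp.comp p contDiffAt_fst).smul
          (hsm.contDiffAt.comp p (contDiffAt_const.mul contDiffAt_snd))
      · have h1 : HasFDerivAt (fun z : ℝ × ℝ => b z.1) _ p :=
          (hbp.differentiableAt (by simp)).hasDerivAt.hasFDerivAt.comp p hasFDerivAt_fst
        have h2 : HasFDerivAt (fun z : ℝ × ℝ => γ (N p.1 * z.2)) _ p :=
          HasFDerivAt.comp p (g := γ) (f := fun z : ℝ × ℝ => N p.1 * z.2)
            (hsm.differentiable (by simp) (N p.1 * p.2)).hasDerivAt.hasFDerivAt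
            (hasFDerivAt_snd.const_mul (N p.1))
        rw [(h1.fun_smul h2).fderiv]
        ext i
        simp
        ring
    · refine ⟨fun _ => 0, ?_, contDiffAt_const, fun v => ?_⟩
      · filter_upwards [continuousAt_fst.eventually h] with z hz
        simp only [spin, hz, zero_smul]
      · have h0 : deriv b p.1 = 0 := by
          rw [EventuallyEq.deriv_eq (f := fun _ => (0 : ℝ)) h, deriv_const]
        simp [h0, h.self_of_nhds]
  refine ⟨fun p hp => ?_, fun p hp v w => ?_⟩
  · obtain ⟨g, hg, hgs, -⟩ := key p hp
    exact (hgs.congr_of_eventuallyEq hg).contDiffWithinAt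
  · obtain ⟨g, hg, -, hgd⟩ := key p hp
    rw [hg.fderiv_eq, hgd, hgd]
    simp only [semiInner_add_left, semiInner_add_right, semiInner_smul_left, semiInner_smul_right,
      semiInner_comm a (deriv γ _) (γ _), hγ.orthogonal isOpen_univ (Set.mem_univ _),
      hγ.norm _ (Set.mem_univ _), hγ.speed _ (Set.mem_univ _), Pi.one_apply]
    ring

/-- Along filters on `I × ℝ`, convergence of the first coordinate and of `Y` at `p` forces
convergence of the second coordinate. -/
def RecoversSnd {n : ℕ} (I : Set ℝ) (Y : ℝ × ℝ → Fin n → ℝ) (p : ℝ × ℝ) : Prop :=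
  ∀ l : Filter (ℝ × ℝ), (∀ᶠ z in l, z ∈ I ×ˢ (Set.univ : Set ℝ)) →
    Tendsto Prod.fst l (𝓝 p.1) → Tendsto Y l (𝓝 (Y p)) → Tendsto Prod.snd l (𝓝 p.2)

/-- Near `t` the factor `b` is nonzero and `N` is constant, so they can be divided out. -/
theorem recoversSnd_spin (hI : IsOpen I) (hγ : EmbedsOn γ Set.univ) (hb : ContinuousOn b I)
    {p : ℝ × ℝ} (hp : p.1 ∈ I) (hN : ConstOffZeros N b p.1) (hb0 : b p.1 ≠ 0) (hN0 : N p.1 ≠ 0) :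
    RecoversSnd I (spin b N γ) p := by
  intro l hl hfst hY
  have hc : ∀ᶠ s in 𝓝 p.1, N s = N p.1 :=
    hN.resolve_right fun h => hb0 h.self_of_nhds
  have hbl : Tendsto (fun z : ℝ × ℝ => b z.1) l (𝓝 (b p.1)) :=
    (hb.continuousAt (hI.mem_nhds hp)).tendsto.comp hfst
  have h1 : Tendsto (fun z => (b z.1)⁻¹ • spin b N γ z) l (𝓝 ((b p.1)⁻¹ • spin b N γ p)) :=
    (hbl.inv₀ hb0).smul hY
  have h2 : Tendsto (fun z : ℝ × ℝ => γ (N p.1 * z.2)) l (𝓝 (γ (N p.1 * p.2))) := by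
    rw [show (b p.1)⁻¹ • spin b N γ p = γ (N p.1 * p.2) from inv_smul_smul₀ hb0 _] at h1
    refine h1.congr' ?_
    filter_upwards [hfst.eventually hc, hbl.eventually_ne hb0] with z hz hbz
    rw [spin, inv_smul_smul₀ hbz, hz]
  have h3 : Tendsto (fun z : ℝ × ℝ => N p.1 * z.2) l (𝓝 (N p.1 * p.2)) :=
    hγ.tendsto (Set.mem_univ _) (Eventually.of_forall fun _ => Set.mem_univ _) h2
  simpa [hN0] using h3.const_mul (N p.1)⁻¹

end Spin

theorem tendsto_append {ι : Type*} {l : Filter ι} {k m : ℕ} {F : ι → Fin k → ℝ}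
    {G : ι → Fin m → ℝ} {x : Fin k → ℝ} {y : Fin m → ℝ} :
    Tendsto (fun i => Fin.append (F i) (G i)) l (𝓝 (Fin.append x y)) ↔
      Tendsto F l (𝓝 x) ∧ Tendsto G l (𝓝 y) := by
  simp only [tendsto_pi_nhds]
  refine ⟨fun h => ⟨fun j => ?_, fun j => ?_⟩, fun h i => ?_⟩
  · simpa using h (Fin.castAdd m j)
  · simpa using h (Fin.natAdd k j)
  · refine Fin.addCases (fun j => ?_) (fun j => ?_) i
    · simpa using h.1 j
    · simpa using h.2 j

section Recover

variable {I : Set ℝ} {k m : ℕ}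

theorem RecoversSnd.append_left {Y : ℝ × ℝ → Fin k → ℝ} {p : ℝ × ℝ} (h : RecoversSnd I Y p)
    (Z : ℝ × ℝ → Fin m → ℝ) : RecoversSnd I (fun p => Fin.append (Y p) (Z p)) p :=
  fun l hl hfst hY => h l hl hfst (tendsto_append.1 hY).1

theorem RecoversSnd.append_right {Z : ℝ × ℝ → Fin m → ℝ} {p : ℝ × ℝ} (h : RecoversSnd I Z p)
    (Y : ℝ × ℝ → Fin k → ℝ) : RecoversSnd I (fun p => Fin.append (Y p) (Z p)) p :=
  fun l hl hfst hY => h l hl hfst (tendsto_append.1 hY).2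

theorem embedsOn_of_recoversSnd {n : ℕ} {f : ℝ × ℝ → Fin m → ℝ} {Y : ℝ × ℝ → Fin n → ℝ}
    (hY : ∀ p ∈ I ×ˢ (Set.univ : Set ℝ), RecoversSnd I Y p)
    (hf : ∀ p ∈ I ×ˢ (Set.univ : Set ℝ), ∀ l : Filter (ℝ × ℝ),
      (∀ᶠ z in l, z ∈ I ×ˢ (Set.univ : Set ℝ)) → Tendsto f l (𝓝 (f p)) →
        Tendsto Prod.fst l (𝓝 p.1) ∧ Tendsto Y l (𝓝 (Y p))) :
    EmbedsOn f (I ×ˢ Set.univ) := by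
  intro p hp
  set l := comap f (𝓝 (f p)) ⊓ 𝓟 (I ×ˢ (Set.univ : Set ℝ)) with hl
  have hlI : ∀ᶠ z in l, z ∈ I ×ˢ (Set.univ : Set ℝ) :=
    mem_inf_of_right (mem_principal_self _)
  have hlf : Tendsto f l (𝓝 (f p)) := tendsto_comap.mono_left inf_le_left
  obtain ⟨h1, h2⟩ := hf p hp l hlI hlf
  exact tendsto_id'.1 (h1.prodMk_nhds (hY p hp l hlI h1 h2))

/-- The parameter `t` is read off a coordinate curve of `f`, and `x` off the remaining block. -/
theorem embedsOn_append_curve {A : ℝ → Fin k → ℝ} {Y : ℝ × ℝ → Fin m → ℝ} (hA : EmbedsOn A I)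
    (hY : ∀ p ∈ I ×ˢ (Set.univ : Set ℝ), RecoversSnd I Y p) :
    EmbedsOn (fun p => Fin.append (A p.1) (Y p)) (I ×ˢ Set.univ) ∧
      EmbedsOn (fun p => Fin.append (Y p) (A p.1)) (I ×ˢ Set.univ) := by
  refine ⟨embedsOn_of_recoversSnd hY fun p hp l hl hf => ?_,
    embedsOn_of_recoversSnd hY fun p hp l hl hf => ?_⟩
  · obtain ⟨h1, h2⟩ := tendsto_append.1 hf
    exact ⟨hA.tendsto hp.1 (hl.mono fun z hz => hz.1) h1, h2⟩
  · obtain ⟨h1, h2⟩ := tendsto_append.1 hf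
    exact ⟨hA.tendsto hp.1 (hl.mono fun z hz => hz.1) h2, h1⟩

/-- On a quadric the radius `r` is a continuous function of `Y`, so that the curve `γ`, and with it
the parameter `t`, can be recovered from `(r γ, Y)`. -/
theorem embedsOn_append_smul {a : ℕ} {ε K : ℝ} {r : ℝ → ℝ} {γ : ℝ → Fin k → ℝ}
    {Y : ℝ × ℝ → Fin m → ℝ} (hγ : EmbedsOn γ I) (hr : ∀ t ∈ I, 0 < r t)
    (hrY : ∀ p ∈ I ×ˢ (Set.univ : Set ℝ), r p.1 ^ 2 = ε * (K - semiInner a (Y p) (Y p)))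
    (hY : ∀ p ∈ I ×ˢ (Set.univ : Set ℝ), RecoversSnd I Y p) :
    EmbedsOn (fun p => Fin.append (r p.1 • γ p.1) (Y p)) (I ×ˢ Set.univ) ∧
      EmbedsOn (fun p => Fin.append (Y p) (r p.1 • γ p.1)) (I ×ˢ Set.univ) := by
  have key : ∀ p ∈ I ×ˢ (Set.univ : Set ℝ), ∀ l : Filter (ℝ × ℝ),
      (∀ᶠ z in l, z ∈ I ×ˢ (Set.univ : Set ℝ)) →
      Tendsto (fun z : ℝ × ℝ => r z.1 • γ z.1) l (𝓝 (r p.1 • γ p.1)) →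
      Tendsto Y l (𝓝 (Y p)) → Tendsto Prod.fst l (𝓝 p.1) := by
    intro p hp l hl h1 h2
    have hrl : Tendsto (fun z : ℝ × ℝ => r z.1) l (𝓝 (r p.1)) := by
      have hsq : ∀ z ∈ I ×ˢ (Set.univ : Set ℝ),
          √(ε * (K - semiInner a (Y z) (Y z))) = r z.1 := fun z hz => by
        rw [← hrY z hz, Real.sqrt_sq (hr _ hz.1).le]
      have h3 : Continuous fun y : Fin m → ℝ => √(ε * (K - semiInner a y y)) :=
        (continuous_const.mul (continuous_const.sub (continuous_semiInner_self a))).sqrt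
      rw [← hsq p hp]
      exact ((h3.tendsto (Y p)).comp h2).congr' (hl.mono fun z hz => hsq z hz)
    have h4 := (hrl.inv₀ (hr _ hp.1).ne').smul h1
    rw [inv_smul_smul₀ (hr _ hp.1).ne'] at h4
    refine hγ.tendsto hp.1 (hl.mono fun z hz => hz.1) (h4.congr' ?_)
    filter_upwards [hl] with z hz
    exact inv_smul_smul₀ (hr _ hz.1).ne' _
  refine ⟨embedsOn_of_recoversSnd hY fun p hp l hl hf => ?_,
    embedsOn_of_recoversSnd hY fun p hp l hl hf => ?_⟩
  · obtain ⟨h1, h2⟩ := tendsto_append.1 hf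
    exact ⟨key p hp l hl h1 h2, h2⟩
  · obtain ⟨h1, h2⟩ := tendsto_append.1 hf
    exact ⟨key p hp l hl h2 h1, h1⟩

end Recover

/-! ### The radius and the speed of the curve in the complementary block -/

/-- If `⟨Y, Y⟩ = q(t)` and `Y` induces `e(t) dt² + η² dx²`, then `(r γ, Y)` with `γ` of speed `w` in
the quadric `⟨γ, γ⟩ = ε` lies in the quadric of value `K` and induces `ρ² dt² + η² dx²`. -/
theorem exists_radius_speed {I : Set ℝ} (hI : IsOpen I) {ε K : ℝ} (hε : ε = 1 ∨ ε = -1)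
    {q e ρ : ℝ → ℝ} (hq : ContDiffOn ℝ ∞ q I) (he : ContDiffOn ℝ ∞ e I)
    (hρ : ContDiffOn ℝ ∞ ρ I) (hK : ∀ t ∈ I, 0 < ε * (K - q t))
    (hlt : ∀ t ∈ I, deriv q t ^ 2 / (4 * (K - q t)) + e t < ρ t ^ 2) :
    ∃ r w : ℝ → ℝ, ContDiffOn ℝ ∞ r I ∧ ContDiffOn ℝ ∞ w I ∧ (∀ t ∈ I, 0 < r t) ∧
      (∀ t ∈ I, 0 < w t) ∧ (∀ t ∈ I, r t ^ 2 = ε * (K - q t)) ∧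
      ∀ t ∈ I, ε * deriv r t ^ 2 + r t ^ 2 * w t ^ 2 = ρ t ^ 2 - e t := by
  have hεε : ε * ε = 1 := by rcases hε with h | h <;> simp [h]
  set r : ℝ → ℝ := fun t => √(ε * (K - q t)) with hr
  have hrs : ContDiffOn ℝ ∞ r I :=
    (contDiffOn_const.mul (contDiffOn_const.sub hq)).sqrt fun t ht => (hK t ht).ne'
  have hrpos : ∀ t ∈ I, 0 < r t := fun t ht => Real.sqrt_pos.2 (hK t ht)
  have hrsq : ∀ t ∈ I, r t ^ 2 = ε * (K - q t) := fun t ht => Real.sq_sqrt (hK t ht).le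
  have hr's : ContDiffOn ℝ ∞ (deriv r) I := hrs.deriv_of_isOpen hI (by simp)
  have hr' : ∀ t ∈ I, ε * deriv r t ^ 2 = deriv q t ^ 2 / (4 * (K - q t)) := fun t ht => by
    have hn := hI.mem_nhds ht
    have h1 := ((hrs.contDiffAt hn).differentiableAt (by simp)).hasDerivAt.fun_pow 2
    have h2 := (((hq.contDiffAt hn).differentiableAt (by simp)).hasDerivAt.const_sub K).const_mul ε
    have h3 := h1.unique (h2.congr_of_eventuallyEq (by
      filter_upwards [hn] with s hs using hrsq s hs))
    have h4 : 2 * r t * deriv r t = -(ε * deriv q t) := by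
      simpa using h3
    have hKq : K - q t ≠ 0 := fun h => by simpa [h] using hK t ht
    rw [eq_div_iff (by simpa using hKq)]
    have h5 : K - q t = ε * r t ^ 2 := by
      rw [hrsq t ht, ← mul_assoc, hεε, one_mul]
    rw [h5]
    calc ε * deriv r t ^ 2 * (4 * (ε * r t ^ 2))
        = ε * ε * (2 * r t * deriv r t) ^ 2 := by ring
      _ = (ε * ε) ^ 2 * deriv q t ^ 2 := by rw [h4]; ring
      _ = deriv q t ^ 2 := by rw [hεε]; ring
  have hw : ∀ t ∈ I, 0 < ρ t ^ 2 - e t - ε * deriv r t ^ 2 := fun t ht => by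
    rw [hr' t ht]
    linarith [hlt t ht]
  refine ⟨r, fun t => √(ρ t ^ 2 - e t - ε * deriv r t ^ 2) / r t, hrs, ?_, hrpos,
    fun t ht => div_pos (Real.sqrt_pos.2 (hw t ht)) (hrpos t ht), hrsq, fun t ht => ?_⟩
  · exact ((((hρ.pow 2).sub he).sub (contDiffOn_const.mul (hr's.pow 2))).sqrt
      fun t ht => (hw t ht).ne').div hrs fun t ht => (hrpos t ht).ne'
  · rw [← mul_pow, mul_div_cancel₀ _ (hrpos t ht).ne', Real.sq_sqrt (hw t ht).le]
    ring

/-! ### Splitting `η` into two oscillating amplitudes -/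

/-- An open subset of the line carries a smooth proper nonnegative function. -/
theorem exists_smooth_exhaustion {I : Set ℝ} (hI : IsOpen I) :
    ∃ s : ℝ → ℝ, ContDiffOn ℝ ∞ s I ∧ (∀ t ∈ I, 0 ≤ s t) ∧
      ∀ K : ℝ, IsCompact {t | t ∈ I ∧ s t ≤ K} := by
  -- `t² + 1 / g(t)`, with `g ≥ 0` smooth and positive exactly on `I`, tends to infinity at the ends
  -- of `I`, whether they are finite or not.
  obtain ⟨g, hgs, hg, hgr⟩ := hI.exists_contDiff_support_eq (n := ⊤)
  have hg0 : ∀ t, 0 ≤ g t := fun t => (hgr (Set.mem_range_self t)).1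
  have hpos : ∀ t, t ∈ I ↔ 0 < g t := fun t => by
    rw [← hgs, Function.mem_support]
    exact ⟨fun h => lt_of_le_of_ne (hg0 t) h.symm, fun h => h.ne'⟩
  refine ⟨fun t => t ^ 2 + 1 / g t, ?_, fun t _ => ?_, fun K => ?_⟩
  · exact (contDiff_id.pow 2).contDiffOn.add
      (contDiffOn_const.div hg.contDiffOn fun t ht => ((hpos t).1 ht).ne')
  · have := hg0 t
    positivity
  · have hset : {t | t ∈ I ∧ t ^ 2 + 1 / g t ≤ K} =
        {t | t ^ 2 ≤ K} ∩ {t | 1 ≤ (K - t ^ 2) * g t} := by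
      ext t
      simp only [Set.mem_ofPred_eq, Set.mem_inter_iff, hpos]
      constructor
      · rintro ⟨h1, h2⟩
        have h3 : 1 / g t ≤ K - t ^ 2 := by linarith
        rw [div_le_iff₀ h1] at h3
        exact ⟨by linarith [one_div_pos.2 h1], h3⟩
      · rintro ⟨h1, h2⟩
        have h3 : 0 < g t := by
          refine lt_of_le_of_ne (hg0 t) fun h => ?_
          rw [← h, mul_zero] at h2
          linarith
        rw [← div_le_iff₀ h3] at h2
        exact ⟨h3, by linarith⟩
    rw [hset]
    refine IsCompact.of_isClosed_subset (isCompact_Icc (a := -√K) (b := √K)) ?_ fun t ht => ?_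
    · exact (isClosed_le (by fun_prop) (by fun_prop)).inter
        (isClosed_le (by fun_prop) ((by fun_prop : Continuous fun t : ℝ => K - t ^ 2).mul
          hg.continuous))
    · exact abs_le.1 (Real.abs_le_sqrt ht.1)

/-- Smooth functions with squares summing to `1`, the first vanishing near the even integers and the
second near the odd ones. -/
theorem exists_alternating_cutoffs :
    ∃ χ : Fin 2 → ℝ → ℝ, (∀ i, ContDiff ℝ ∞ (χ i)) ∧ (∀ y, χ 0 y ^ 2 + χ 1 y ^ 2 = 1) ∧
      ∀ (i : Fin 2) (n : ℕ) (y : ℝ), y + (i : ℕ) = 2 * n → ∀ᶠ z in 𝓝 y, χ i z = 0 := by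
  -- The angle `T` is `0` near the even integers and `π / 2` near the odd ones.
  set T : ℝ → ℝ := fun y => Real.pi / 2 * Real.smoothTransition (1 / 2 - Real.cos (Real.pi * y))
    with hT
  have hTs : ContDiff ℝ ∞ T := by
    refine contDiff_const.mul (Real.smoothTransition.contDiff.comp ?_)
    exact contDiff_const.sub (Real.contDiff_cos.comp (contDiff_const.mul contDiff_id))
  have hc : Continuous fun y : ℝ => Real.cos (Real.pi * y) := by fun_prop
  refine ⟨![fun y => Real.sin (T y), fun y => Real.cos (T y)], fun i => ?_, fun y => ?_,
    fun i n y hy => ?_⟩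
  · fin_cases i
    · exact Real.contDiff_sin.comp hTs
    · exact Real.contDiff_cos.comp hTs
  · simp
  · fin_cases i
    · have h1 : (1 / 2 : ℝ) < Real.cos (Real.pi * y) := by
        rw [show Real.pi * y = n * (2 * Real.pi) by
          have : y = 2 * n := by simpa using hy
          rw [this]; ring, Real.cos_nat_mul_two_pi]
        norm_num
      filter_upwards [hc.continuousAt.eventually (lt_mem_nhds h1)] with z hz
      have : T z = 0 := by
        simp only [hT]
        rw [Real.smoothTransition.zero_of_nonpos (by linarith), mul_zero]
      simp [this]
    · have h1 : Real.cos (Real.pi * y) < (-1 / 2 : ℝ) := by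
        rw [show Real.pi * y = n * (2 * Real.pi) - Real.pi by
          have : y = 2 * n - 1 := by
            have : y + 1 = 2 * n := by simpa using hy
            linarith
          rw [this]; ring, Real.cos_nat_mul_two_pi_sub_pi]
        norm_num
      filter_upwards [hc.continuousAt.eventually (gt_mem_nhds h1)] with z hz
      have : T z = Real.pi / 2 := by
        simp only [hT]
        rw [Real.smoothTransition.one_of_one_le (by linarith), mul_one]
      simp [this]

/-- An integer step function above a given continuous function, jumping only at parameters near
which `ψ` vanishes. On each compact piece of the exhaustion `s` it is enough to take a large
constant. -/
theorem exists_step {I : Set ℝ} (hI : IsOpen I) {s : ℝ → ℝ} (hs : ContinuousOn s I)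
    (hs0 : ∀ t ∈ I, 0 ≤ s t) (hsc : ∀ K : ℝ, IsCompact {t | t ∈ I ∧ s t ≤ K}) {j : ℝ}
    (hj : 0 ≤ j) {ψ F : ℝ → ℝ} (hF : ContinuousOn F I)
    (hψ : ∀ t ∈ I, ∀ n : ℕ, s t + j = 2 * n → ∀ᶠ u in 𝓝 t, ψ u = 0) :
    ∃ N : ℝ → ℕ, (∀ t ∈ I, F t ≤ N t) ∧
      ∀ t ∈ I, (∀ᶠ u in 𝓝 t, N u = N t) ∨ ∀ᶠ u in 𝓝 t, ψ u = 0 := by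
  have hM : ∀ n : ℕ, ∃ M : ℕ, ∀ t ∈ I, s t ≤ 2 * n + 2 → F t ≤ M := fun n => by
    obtain ⟨B, hB⟩ := ((hsc (2 * n + 2)).image_of_continuousOn
      (hF.mono fun t ht => ht.1)).bddAbove
    obtain ⟨M, hM⟩ := exists_nat_ge B
    exact ⟨M, fun t ht hst => (hB ⟨t, ⟨ht, hst⟩, rfl⟩).trans hM⟩
  choose M hM using hM
  -- The floor jumps only where `s t + j` is an even integer.
  refine ⟨fun t => M ⌊(s t + j) / 2⌋₊, fun t ht => ?_, fun t ht => ?_⟩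
  · refine hM _ t ht ?_
    have := Nat.lt_floor_add_one ((s t + j) / 2)
    linarith
  · set n := ⌊(s t + j) / 2⌋₊ with hn
    have h0 : 0 ≤ (s t + j) / 2 := by linarith [hs0 t ht]
    by_cases h : s t + j = 2 * n
    · exact Or.inr (hψ t ht n h)
    · left
      have h1 : (n : ℝ) ≤ (s t + j) / 2 := Nat.floor_le h0
      have h2 : (s t + j) / 2 < n + 1 := Nat.lt_floor_add_one _
      have h3 : (n : ℝ) < (s t + j) / 2 := lt_of_le_of_ne h1 fun h' => h (by linarith)
      have hc : ContinuousAt (fun u => (s u + j) / 2) t :=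
        ((hs.continuousAt (hI.mem_nhds ht)).add continuousAt_const).div_const 2
      filter_upwards [hc.eventually (lt_mem_nhds h3), hc.eventually (gt_mem_nhds h2)]
        with u hu1 hu2
      rw [(Nat.floor_eq_iff (n.cast_nonneg.trans hu1.le)).2 ⟨hu1.le, hu2⟩]

/-- Two amplitudes `b i` and integer frequencies `N i` such that the maps `b i (t) γ (N i (t) x)`
together have the coefficient `η²` of `dx²`, while the amplitudes and their derivatives are
small. The bound `ρ / 3` keeps twice the sum of the squared derivatives below `ρ²`. -/
structure IsAmplitudePair (I : Set ℝ) (ρ η : ℝ → ℝ) (κ : ℝ) (b : Fin 2 → ℝ → ℝ)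
    (N : Fin 2 → ℝ → ℕ) : Prop where
  smooth : ∀ i, ContDiffOn ℝ ∞ (b i) I
  step : ∀ i, ∀ t ∈ I, ConstOffZeros (fun u => (N i u : ℝ)) (b i) t
  one_le : ∀ i, ∀ t ∈ I, 1 ≤ N i t
  amplitude_le : ∀ i, ∀ t ∈ I, |b i t| ≤ κ
  deriv_le : ∀ i, ∀ t ∈ I, |deriv (b i) t| ≤ ρ t / 3
  sum_sq : ∀ t ∈ I, b 0 t ^ 2 * N 0 t ^ 2 + b 1 t ^ 2 * N 1 t ^ 2 = η t ^ 2

theorem exists_isAmplitudePair {I : Set ℝ} (hI : IsOpen I) {ρ η : ℝ → ℝ}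
    (hρ : ContDiffOn ℝ ∞ ρ I) (hη : ContDiffOn ℝ ∞ η I) (hρpos : ∀ t ∈ I, 0 < ρ t) {κ : ℝ}
    (hκ : 0 < κ) : ∃ b N, IsAmplitudePair I ρ η κ b N := by
  obtain ⟨s, hs, hs0, hsc⟩ := exists_smooth_exhaustion hI
  obtain ⟨χ, hχ, hχ1, hχ0⟩ := exists_alternating_cutoffs
  set ψ : Fin 2 → ℝ → ℝ := fun i t => η t * χ i (s t) with hψ
  have hψs : ∀ i, ContDiffOn ℝ ∞ (ψ i) I := fun i =>
    hη.mul ((hχ i).comp_contDiffOn hs)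
  have hψ's : ∀ i, ContDiffOn ℝ ∞ (deriv (ψ i)) I := fun i =>
    (hψs i).deriv_of_isOpen hI (by simp)
  -- The summand `1` makes `N ≥ 1`, the other two give the bounds on `ψ / N` and its derivative.
  have hstep : ∀ i : Fin 2, ∃ N : ℝ → ℕ,
      (∀ t ∈ I, 1 + |ψ i t| / κ + |deriv (ψ i) t| / (ρ t / 3) ≤ N t) ∧
      ∀ t ∈ I, (∀ᶠ u in 𝓝 t, N u = N t) ∨ ∀ᶠ u in 𝓝 t, ψ i u = 0 := fun i => by
    refine exists_step hI hs.continuousOn hs0 hsc (j := ((i : ℕ) : ℝ)) (Nat.cast_nonneg _)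
      ?_ fun t ht n hn => ?_
    · refine (continuousOn_const.add ((hψs i).continuousOn.abs.div_const κ)).add
        ((hψ's i).continuousOn.abs.div (hρ.continuousOn.div_const 3) fun t ht => ?_)
      have := hρpos t ht
      positivity
    · filter_upwards [(hs.continuousOn.continuousAt (hI.mem_nhds ht)).eventually (hχ0 i n _ hn)]
        with u hu
      simp only [hψ, hu, mul_zero]
  choose N hN hNψ using hstep
  have hρ3 : ∀ t ∈ I, 0 < ρ t / 3 := fun t ht => by linarith [hρpos t ht]
  have hN1 : ∀ i, ∀ t ∈ I, (1 : ℝ) ≤ N i t := fun i t ht => by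
    have h1 : 0 ≤ |ψ i t| / κ := by positivity
    have h2 : 0 ≤ |deriv (ψ i) t| / (ρ t / 3) := div_nonneg (abs_nonneg _) (hρ3 t ht).le
    linarith [hN i t ht]
  have hloc : ∀ i, ∀ t ∈ I, (fun u => ψ i u / N i u) =ᶠ[𝓝 t] fun u => ψ i u / N i t :=
    fun i t ht => by
      rcases hNψ i t ht with h | h <;> filter_upwards [h] with u hu <;> simp [hu]
  have hd : ∀ i, ∀ t ∈ I, deriv (fun u => ψ i u / N i u) t = deriv (ψ i) t / N i t :=
    fun i t ht => by rw [(hloc i t ht).deriv_eq, deriv_div_const]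
  refine ⟨fun i t => ψ i t / N i t, N, fun i t ht => ?_, fun i t ht => ?_, fun i t ht => ?_,
    fun i t ht => ?_, fun i t ht => ?_, fun t ht => ?_⟩
  · exact ((((hψs i).contDiffAt (hI.mem_nhds ht)).div_const _).congr_of_eventuallyEq
      (hloc i t ht)).contDiffWithinAt
  · rcases hNψ i t ht with h | h
    · exact Or.inl (h.mono fun u hu => by simp only [hu])
    · exact Or.inr (h.mono fun u hu => by simp only [hu, zero_div])
  · exact_mod_cast hN1 i t ht
  · have h0 : (0 : ℝ) < N i t := zero_lt_one.trans_le (hN1 i t ht)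
    have h2 : 0 ≤ |deriv (ψ i) t| / (ρ t / 3) := div_nonneg (abs_nonneg _) (hρ3 t ht).le
    have h3 : |ψ i t| / κ ≤ N i t := by linarith [hN i t ht]
    rw [abs_div, abs_of_pos h0, div_le_iff₀ h0, mul_comm]
    exact (div_le_iff₀ hκ).1 h3
  · have h0 : (0 : ℝ) < N i t := zero_lt_one.trans_le (hN1 i t ht)
    have h1 : 0 ≤ |ψ i t| / κ := by positivity
    have h3 : |deriv (ψ i) t| / (ρ t / 3) ≤ N i t := by linarith [hN i t ht]
    rw [hd i t ht, abs_div, abs_of_pos h0, div_le_iff₀ h0, mul_comm]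
    exact (div_le_iff₀ (hρ3 t ht)).1 h3
  · have h0 : (N 0 t : ℝ) ≠ 0 := (zero_lt_one.trans_le (hN1 0 t ht)).ne'
    have h1 : (N 1 t : ℝ) ≠ 0 := (zero_lt_one.trans_le (hN1 1 t ht)).ne'
    rw [← mul_pow, ← mul_pow, div_mul_cancel₀ _ h0, div_mul_cancel₀ _ h1]
    simp only [hψ]
    linear_combination η t ^ 2 * hχ1 (s t)

/-! ### Oscillating blocks -/

/-- The two blocks `b i (t) γ (N i (t) x)` put together. -/
def oscillation {k : ℕ} (b : Fin 2 → ℝ → ℝ) (N : Fin 2 → ℝ → ℕ) (γ : ℝ → Fin k → ℝ)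
    (p : ℝ × ℝ) : Fin (k + k) → ℝ :=
  Fin.append (spin (b 0) (fun t => N 0 t) γ p) (spin (b 1) (fun t => N 1 t) γ p)

section Oscillation

variable {I : Set ℝ} {ρ η : ℝ → ℝ} {κ : ℝ} {b : Fin 2 → ℝ → ℝ} {N : Fin 2 → ℝ → ℕ} {k : ℕ}
  {γ : ℝ → Fin k → ℝ}

theorem hasMetric_oscillation (hI : IsOpen I) (h : IsAmplitudePair I ρ η κ b N)
    (hγ : IsQuadricCurve Set.univ 0 1 1 γ) :
    HasMetric I 0 (oscillation b N γ) (fun t => deriv (b 0) t ^ 2 + deriv (b 1) t ^ 2)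
      (fun t => η t ^ 2) :=
  ((hasMetric_spin hI hγ (h.smooth 0) (h.step 0)).append hI (Nat.zero_le _)
    (hasMetric_spin hI hγ (h.smooth 1) (h.step 1))).congr
      (fun t _ => by ring) fun t ht => h.sum_sq t ht

theorem semiInner_oscillation (hγ : IsQuadricCurve Set.univ 0 1 1 γ) (p : ℝ × ℝ) :
    semiInner 0 (oscillation b N γ p) (oscillation b N γ p) = b 0 p.1 ^ 2 + b 1 p.1 ^ 2 := by
  rw [oscillation, semiInner_append 0 (Nat.zero_le _), semiInner_spin hγ, semiInner_spin hγ]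
  ring

/-- As `η` has no zeros on `I`, at every parameter one of the two amplitudes is nonzero, and its
frequency is then locally constant. -/
theorem recoversSnd_oscillation (hI : IsOpen I) (h : IsAmplitudePair I ρ η κ b N)
    (hη : ∀ t ∈ I, 0 < η t) (hγ : EmbedsOn γ Set.univ) :
    ∀ p ∈ I ×ˢ (Set.univ : Set ℝ), RecoversSnd I (oscillation b N γ) p := by
  intro p hp
  have hN : ∀ i, (N i p.1 : ℝ) ≠ 0 := fun i =>
    Nat.cast_ne_zero.2 (Nat.one_le_iff_ne_zero.1 (h.one_le i _ hp.1))
  have key : ∀ i, b i p.1 ≠ 0 → RecoversSnd I (spin (b i) (fun t => N i t) γ) p := fun i hi =>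
    recoversSnd_spin hI hγ (h.smooth i).continuousOn hp.1 (h.step i _ hp.1) hi (hN i)
  by_cases h0 : b 0 p.1 = 0
  · refine (key 1 fun h1 => ?_).append_right _
    have h2 := h.sum_sq _ hp.1
    rw [h0, h1] at h2
    have := hη _ hp.1
    nlinarith
  · exact (key 0 h0).append_left _

theorem IsAmplitudePair.sum_deriv_sq_le (h : IsAmplitudePair I ρ η κ b N) {t : ℝ} (ht : t ∈ I) :
    deriv (b 0) t ^ 2 + deriv (b 1) t ^ 2 ≤ 2 / 9 * ρ t ^ 2 := by
  have h0 := sq_le_sq' (abs_le.1 (h.deriv_le 0 t ht)).1 (abs_le.1 (h.deriv_le 0 t ht)).2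
  have h1 := sq_le_sq' (abs_le.1 (h.deriv_le 1 t ht)).1 (abs_le.1 (h.deriv_le 1 t ht)).2
  nlinarith

theorem IsAmplitudePair.deriv_sum_sq (h : IsAmplitudePair I ρ η κ b N) (hI : IsOpen I) {t : ℝ}
    (ht : t ∈ I) : deriv (fun t => b 0 t ^ 2 + b 1 t ^ 2) t =
      2 * (b 0 t * deriv (b 0) t + b 1 t * deriv (b 1) t) := by
  have hd : ∀ i, HasDerivAt (b i) (deriv (b i) t) t := fun i =>
    (((h.smooth i).contDiffAt (hI.mem_nhds ht)).differentiableAt (by simp)).hasDerivAt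
  rw [(((hd 0).fun_pow 2).fun_add ((hd 1).fun_pow 2)).deriv]
  simp
  ring

theorem IsAmplitudePair.contDiffOn_sum_sq (h : IsAmplitudePair I ρ η κ b N) :
    ContDiffOn ℝ ∞ (fun t => b 0 t ^ 2 + b 1 t ^ 2) I :=
  ((h.smooth 0).pow 2).add ((h.smooth 1).pow 2)

theorem IsAmplitudePair.contDiffOn_sum_deriv_sq (h : IsAmplitudePair I ρ η κ b N)
    (hI : IsOpen I) : ContDiffOn ℝ ∞ (fun t => deriv (b 0) t ^ 2 + deriv (b 1) t ^ 2) I :=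
  (((h.smooth 0).deriv_of_isOpen hI (by simp)).pow 2).add
    (((h.smooth 1).deriv_of_isOpen hI (by simp)).pow 2)

/-- The circle of radius `1` makes oscillations with integer frequencies `2π`-periodic in `x`. -/
theorem oscillation_circle_periodic (t : ℝ) :
    oscillation b N (fun x => ![Real.cos x, Real.sin x]) (t, 2 * Real.pi) =
      oscillation b N (fun x => ![Real.cos x, Real.sin x]) (t, 0) := by
  have h1 : ∀ n : ℕ, Real.cos (n * (2 * Real.pi)) = 1 := Real.cos_nat_mul_two_pi
  have h2 : ∀ n : ℕ, Real.sin (n * (2 * Real.pi)) = 0 := fun n => by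
    rw [← mul_assoc, ← Nat.cast_ofNat (R := ℝ), ← Nat.cast_mul, Real.sin_nat_mul_pi]
  simp [oscillation, spin, h1, h2]

end Oscillation

theorem isQuadricCurve_unit_circle :
    IsQuadricCurve Set.univ 0 1 1 fun x => ![Real.cos x, Real.sin x] :=
  isQuadricCurve_circle contDiffOn_id fun t _ => hasDerivAt_id t

theorem isQuadricCurve_unit_hyperbola :
    IsQuadricCurve Set.univ 1 (-1) 1 fun x => ![Real.cosh x, Real.sinh x] :=
  isQuadricCurve_hyperbola contDiffOn_id fun t _ => hasDerivAt_id t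

theorem embedsOn_unit_hyperbola :
    EmbedsOn (fun x : ℝ => ![Real.cosh x, Real.sinh x]) Set.univ :=
  embedsOn_hyperbola isOpen_univ (strictMono_id.strictMonoOn _)

theorem exists_unit_spiral :
    ∃ γ : ℝ → Fin 4 → ℝ, IsQuadricCurve Set.univ 0 1 1 γ ∧ EmbedsOn γ Set.univ :=
  exists_spiral isOpen_univ Set.ordConnected_univ Set.univ_nonempty contDiffOn_const
    fun _ _ => one_pos

/-! ### Completing a block to an isometric immersion -/

theorem HasMetric.isIsometricImmersion {I : Set ℝ} {a n : ℕ} {f : ℝ × ℝ → Fin n → ℝ}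
    {ρ η : ℝ → ℝ} (h : HasMetric I a f (fun t => ρ t ^ 2) fun t => η t ^ 2)
    {S : Set (Fin n → ℝ)} (hS : Set.MapsTo f (I ×ˢ Set.univ) S) :
    IsIsometricImmersion I ρ η (fun _ => semiInner a) S f :=
  ⟨h.smooth, hS, h.metric⟩

theorem IsIsometricImmersion.isIsometricEmbedding {E : Type*} [NormedAddCommGroup E]
    [NormedSpace ℝ E] {I : Set ℝ} {ρ η : ℝ → ℝ} {G : E → E → E → ℝ} {S : Set E} {f : ℝ × ℝ → E}
    (h : IsIsometricImmersion I ρ η G S f) (hf : EmbedsOn f (I ×ˢ Set.univ)) :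
    IsIsometricEmbedding I ρ η G S f :=
  ⟨h, hf.isEmbedding h.smooth.continuousOn⟩

section Completion

variable {I : Set ℝ} {ρ η e : ℝ → ℝ}

/-- One more flat coordinate, depending on `t` only, supplies the missing part `ρ² - e` of the
coefficient of `dt²`. -/
theorem exists_flat_coordinate (hI : IsOpen I) (hI' : I.OrdConnected) (hne : I.Nonempty)
    (hρ : ContDiffOn ℝ ∞ ρ I) (he : ContDiffOn ℝ ∞ e I) (hlt : ∀ t ∈ I, e t < ρ t ^ 2) :
    ∃ A : ℝ → Fin 1 → ℝ, HasMetric I 0 (fun p => A p.1) (fun t => ρ t ^ 2 - e t) (fun _ => 0) ∧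
      EmbedsOn A I := by
  have hpos : ∀ t ∈ I, 0 < ρ t ^ 2 - e t := fun t ht => sub_pos.2 (hlt t ht)
  obtain ⟨W, hW, hd⟩ := exists_primitive hI hI' hne
    (((hρ.pow 2).sub he).sqrt fun t ht => (hpos t ht).ne')
  refine ⟨fun t => ![W t], HasMetric.of_curve hI (contDiffOn_vecCons hW contDiffOn_vecEmpty)
    fun t ht => ?_, EmbedsOn.of_comp (continuous_apply 0) (embedsOn_of_strictMonoOn hI
      (strictMonoOn_of_hasDerivAt_pos hI hI' hd fun t ht => Real.sqrt_pos.2 (hpos t ht)))⟩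
  rw [(hasDerivAt_vecCons (hd t ht) hasDerivAt_vecEmpty).deriv]
  simp [semiInner, Real.mul_self_sqrt (hpos t ht).le]

variable {q : ℝ → ℝ} {ε K : ℝ} {k m a : ℕ} {P : (ℝ → Fin k → ℝ) → Prop} {Y : ℝ × ℝ → Fin m → ℝ}

/-- A positive definite block `Y` is completed by a curve in front of it to an isometric immersion
into the quadric of value `K`. The predicate `P` passes on further properties of the curve. -/
theorem exists_completion_left (hI : IsOpen I) (hρ : ContDiffOn ℝ ∞ ρ I) (hε : ε = 1 ∨ ε = -1)
    (hq : ContDiffOn ℝ ∞ q I) (he : ContDiffOn ℝ ∞ e I) (hK : ∀ t ∈ I, 0 < ε * (K - q t))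
    (hlt : ∀ t ∈ I, deriv q t ^ 2 / (4 * (K - q t)) + e t < ρ t ^ 2)
    (hcurve : ∀ w : ℝ → ℝ, ContDiffOn ℝ ∞ w I → (∀ t ∈ I, 0 < w t) →
      ∃ γ : ℝ → Fin k → ℝ, IsQuadricCurve I a ε w γ ∧ P γ) (ha : a ≤ k)
    (hY : HasMetric I 0 Y e fun t => η t ^ 2) (hYq : ∀ p, semiInner 0 (Y p) (Y p) = q p.1) :
    ∃ (r : ℝ → ℝ) (γ : ℝ → Fin k → ℝ), (∀ t ∈ I, 0 < r t) ∧
      (∀ p ∈ I ×ˢ (Set.univ : Set ℝ), r p.1 ^ 2 = ε * (K - semiInner 0 (Y p) (Y p))) ∧ P γ ∧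
      IsIsometricImmersion I ρ η (fun _ => semiInner a) {x | semiInner a x x = K}
        (fun p => Fin.append (r p.1 • γ p.1) (Y p)) := by
  obtain ⟨r, w, hr, hw, hr0, hw0, hrq, hrw⟩ := exists_radius_speed hI hε hq he hρ hK hlt
  obtain ⟨γ, hγ, hP⟩ := hcurve w hw hw0
  refine ⟨r, γ, hr0, fun p hp => by rw [hYq, hrq _ hp.1], hP,
    (((HasMetric.of_curve hI (hr.smul hγ.smooth) fun t ht =>
      (hγ.semiInner_deriv_smul hI hr ht).trans (hrw t ht)).append hI ha hY).congr
        (fun t _ => by ring) fun t _ => by ring).isIsometricImmersion fun p hp => ?_⟩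
  have hεε : ε * ε = 1 := by rcases hε with h | h <;> simp [h]
  rw [Set.mem_ofPred_eq, semiInner_append a ha, hYq, Pi.smul_apply',
    semiInner_smul_left, semiInner_smul_right, hγ.norm _ hp.1]
  linear_combination ε * hrq _ hp.1 + (K - q p.1) * hεε

/-- A block `Y` carrying the negative coordinates is completed by a curve in a Euclidean space to an
isometric immersion into the quadric of value `K`. -/
theorem exists_completion_right (hI : IsOpen I) (hρ : ContDiffOn ℝ ∞ ρ I)
    (hq : ContDiffOn ℝ ∞ q I) (he : ContDiffOn ℝ ∞ e I) (hK : ∀ t ∈ I, 0 < K - q t)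
    (hlt : ∀ t ∈ I, deriv q t ^ 2 / (4 * (K - q t)) + e t < ρ t ^ 2)
    (hcurve : ∀ w : ℝ → ℝ, ContDiffOn ℝ ∞ w I → (∀ t ∈ I, 0 < w t) →
      ∃ γ : ℝ → Fin k → ℝ, IsQuadricCurve I 0 1 w γ ∧ P γ) (ha : a ≤ m)
    (hY : HasMetric I a Y e fun t => η t ^ 2) (hYq : ∀ p, semiInner a (Y p) (Y p) = q p.1) :
    ∃ (r : ℝ → ℝ) (γ : ℝ → Fin k → ℝ), (∀ t ∈ I, 0 < r t) ∧
      (∀ p ∈ I ×ˢ (Set.univ : Set ℝ), r p.1 ^ 2 = 1 * (K - semiInner a (Y p) (Y p))) ∧ P γ ∧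
      IsIsometricImmersion I ρ η (fun _ => semiInner a) {x | semiInner a x x = K}
        (fun p => Fin.append (Y p) (r p.1 • γ p.1)) := by
  obtain ⟨r, w, hr, hw, hr0, hw0, hrq, hrw⟩ :=
    exists_radius_speed hI (Or.inl rfl) hq he hρ (by simpa using hK) hlt
  obtain ⟨γ, hγ, hP⟩ := hcurve w hw hw0
  refine ⟨r, γ, hr0, fun p hp => by rw [hYq, hrq _ hp.1], hP,
    ((hY.append hI ha (HasMetric.of_curve hI (hr.smul hγ.smooth) fun t ht =>
      (hγ.semiInner_deriv_smul hI hr ht).trans (hrw t ht))).congr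
        (fun t _ => by ring) fun t _ => by ring).isIsometricImmersion fun p hp => ?_⟩
  rw [Set.mem_ofPred_eq, semiInner_append a ha, hYq, Pi.smul_apply',
    semiInner_smul_left, semiInner_smul_right, hγ.norm _ hp.1]
  linear_combination hrq _ hp.1

end Completion

section Curves

variable {I : Set ℝ} {w : ℝ → ℝ}

/-- Arcs of the unit circle of prescribed speed. They need not be embedded, whence the trivial side
condition. -/
theorem exists_circle (hI : IsOpen I) (hI' : I.OrdConnected) (hne : I.Nonempty)
    (hw : ContDiffOn ℝ ∞ w I) : ∃ γ : ℝ → Fin 2 → ℝ, IsQuadricCurve I 0 1 w γ ∧ True := by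
  obtain ⟨θ, hθ, hd⟩ := exists_primitive hI hI' hne hw
  exact ⟨_, isQuadricCurve_circle hθ hd, trivial⟩

theorem exists_hyperbola (hI : IsOpen I) (hI' : I.OrdConnected) (hne : I.Nonempty)
    (hw : ContDiffOn ℝ ∞ w I) (hpos : ∀ t ∈ I, 0 < w t) :
    ∃ γ : ℝ → Fin 2 → ℝ, IsQuadricCurve I 1 (-1) w γ ∧ (∀ t, 0 < γ t 0) ∧ EmbedsOn γ I := by
  obtain ⟨θ, hθ, hd⟩ := exists_primitive hI hI' hne hw
  exact ⟨_, isQuadricCurve_hyperbola hθ hd, fun t => by simpa using Real.cosh_pos (θ t),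
    embedsOn_hyperbola hI (strictMonoOn_of_hasDerivAt_pos hI hI' hd hpos)⟩

end Curves

section Targets

variable {I : Set ℝ} {ρ η : ℝ → ℝ} {c : ℝ}

theorem not_injOn_of_periodic {E : Type*} {f : ℝ × ℝ → E} (hne : I.Nonempty) {L : ℝ} (hL : L ≠ 0)
    (hf : ∀ t, f (t, L) = f (t, 0)) : ¬ Set.InjOn f (I ×ˢ Set.univ) := by
  obtain ⟨t, ht⟩ := hne
  intro h
  have := h (x₁ := (t, L)) (x₂ := (t, 0)) ⟨ht, Set.mem_univ _⟩ ⟨ht, Set.mem_univ _⟩ (hf t)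
  exact hL (congrArg Prod.snd this)

/-! ### Riemannian space forms -/

section Riemannian

variable {κ : ℝ} {b : Fin 2 → ℝ → ℝ} {N : Fin 2 → ℝ → ℕ} {k : ℕ} {γ : ℝ → Fin k → ℝ}

theorem exists_flat_oscillation (hI : IsOpen I) (hI' : I.OrdConnected) (hne : I.Nonempty)
    (hρ : ContDiffOn ℝ ∞ ρ I) (hρpos : ∀ t ∈ I, 0 < ρ t)
    (h : IsAmplitudePair I ρ η κ b N) (hγ : IsQuadricCurve Set.univ 0 1 1 γ) :
    ∃ A : ℝ → Fin 1 → ℝ, EmbedsOn A I ∧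
      IsIsometricImmersion I ρ η (fun _ => semiInner 0) Set.univ
        (fun p => Fin.append (A p.1) (oscillation b N γ p)) := by
  obtain ⟨A, hA, hAe⟩ := exists_flat_coordinate hI hI' hne hρ (h.contDiffOn_sum_deriv_sq hI)
    fun t ht => by nlinarith [h.sum_deriv_sq_le ht, hρpos t ht]
  exact ⟨A, hAe, ((hA.append hI (Nat.zero_le _) (hasMetric_oscillation hI h hγ)).congr
    (fun t _ => by ring) fun t _ => by ring).isIsometricImmersion (Set.mapsTo_univ _ _)⟩

/-- Here `K - q` is negative, so that the radius contributes a nonpositive term to the coefficient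
of `dt²` and no bound on the amplitudes is needed. -/
theorem exists_hyperbolic_oscillation (hI : IsOpen I) (hI' : I.OrdConnected) (hne : I.Nonempty)
    (hρ : ContDiffOn ℝ ∞ ρ I) (hρpos : ∀ t ∈ I, 0 < ρ t) (hc : 0 < c)
    (h : IsAmplitudePair I ρ η κ b N) (hγ : IsQuadricCurve Set.univ 0 1 1 γ) :
    ∃ (r : ℝ → ℝ) (δ : ℝ → Fin 2 → ℝ), (∀ t ∈ I, 0 < r t) ∧
      (∀ p ∈ I ×ˢ (Set.univ : Set ℝ), r p.1 ^ 2 =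
        -1 * (-(1 / c) - semiInner 0 (oscillation b N γ p) (oscillation b N γ p))) ∧
      ((∀ t, 0 < δ t 0) ∧ EmbedsOn δ I) ∧
      IsIsometricImmersion I ρ η (fun _ => semiInner 1) {x | semiInner 1 x x = -(1 / c)}
        (fun p => Fin.append (r p.1 • δ p.1) (oscillation b N γ p)) := by
  have hc' : 0 < 1 / c := one_div_pos.2 hc
  refine exists_completion_left hI hρ (Or.inr rfl) h.contDiffOn_sum_sq
    (h.contDiffOn_sum_deriv_sq hI) (fun t _ => ?_) (fun t ht => ?_)
    (fun w hw hw0 => exists_hyperbola hI hI' hne hw hw0) one_le_two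
    (hasMetric_oscillation hI h hγ) (semiInner_oscillation hγ)
  · nlinarith [sq_nonneg (b 0 t), sq_nonneg (b 1 t)]
  · have h1 : deriv (fun t => b 0 t ^ 2 + b 1 t ^ 2) t ^ 2 /
        (4 * (-(1 / c) - (b 0 t ^ 2 + b 1 t ^ 2))) ≤ 0 := by
      refine div_nonpos_of_nonneg_of_nonpos (sq_nonneg _) ?_
      nlinarith [sq_nonneg (b 0 t), sq_nonneg (b 1 t)]
    nlinarith [h.sum_deriv_sq_le ht, hρpos t ht]

/-- The bound `q ≤ 1 / (2c)` on `q = |Y|²` makes the contribution `q'² / (4 (1 / c - q))` of the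
radius at most that of the derivatives of the amplitudes, by the Cauchy–Schwarz inequality. -/
theorem exists_spherical_oscillation {j : ℕ} {P : (ℝ → Fin j → ℝ) → Prop} (hI : IsOpen I)
    (hρ : ContDiffOn ℝ ∞ ρ I) (hρpos : ∀ t ∈ I, 0 < ρ t)
    (hκ : 4 * κ ^ 2 = 1 / c) (hκ0 : 0 < κ) (h : IsAmplitudePair I ρ η κ b N)
    (hγ : IsQuadricCurve Set.univ 0 1 1 γ)
    (hcurve : ∀ w : ℝ → ℝ, ContDiffOn ℝ ∞ w I → (∀ t ∈ I, 0 < w t) →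
      ∃ δ : ℝ → Fin j → ℝ, IsQuadricCurve I 0 1 w δ ∧ P δ) :
    ∃ (r : ℝ → ℝ) (δ : ℝ → Fin j → ℝ), (∀ t ∈ I, 0 < r t) ∧
      (∀ p ∈ I ×ˢ (Set.univ : Set ℝ), r p.1 ^ 2 =
        1 * (1 / c - semiInner 0 (oscillation b N γ p) (oscillation b N γ p))) ∧ P δ ∧
      IsIsometricImmersion I ρ η (fun _ => semiInner 0) {x | semiInner 0 x x = 1 / c}
        (fun p => Fin.append (r p.1 • δ p.1) (oscillation b N γ p)) := by
  have hb : ∀ t ∈ I, b 0 t ^ 2 + b 1 t ^ 2 ≤ 2 * κ ^ 2 := fun t ht => by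
    have h0 := sq_le_sq' (abs_le.1 (h.amplitude_le 0 t ht)).1 (abs_le.1 (h.amplitude_le 0 t ht)).2
    have h1 := sq_le_sq' (abs_le.1 (h.amplitude_le 1 t ht)).1 (abs_le.1 (h.amplitude_le 1 t ht)).2
    linarith
  refine exists_completion_left hI hρ (Or.inl rfl) h.contDiffOn_sum_sq
    (h.contDiffOn_sum_deriv_sq hI) (fun t ht => ?_) (fun t ht => ?_) hcurve (Nat.zero_le _)
    (hasMetric_oscillation hI h hγ) (semiInner_oscillation hγ)
  · nlinarith [hb t ht]
  · have h1 : 0 < 1 / c - (b 0 t ^ 2 + b 1 t ^ 2) := by nlinarith [hb t ht]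
    have h2 : deriv (fun t => b 0 t ^ 2 + b 1 t ^ 2) t ^ 2 /
        (4 * (1 / c - (b 0 t ^ 2 + b 1 t ^ 2))) ≤ deriv (b 0) t ^ 2 + deriv (b 1) t ^ 2 := by
      rw [h.deriv_sum_sq hI ht, div_le_iff₀ (by linarith)]
      have h3 : (b 0 t * deriv (b 0) t + b 1 t * deriv (b 1) t) ^ 2 ≤
          (b 0 t ^ 2 + b 1 t ^ 2) * (deriv (b 0) t ^ 2 + deriv (b 1) t ^ 2) := by
        nlinarith [sq_nonneg (b 0 t * deriv (b 1) t - b 1 t * deriv (b 0) t)]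
      have h4 : (b 0 t ^ 2 + b 1 t ^ 2) * (deriv (b 0) t ^ 2 + deriv (b 1) t ^ 2) ≤
          (1 / c - (b 0 t ^ 2 + b 1 t ^ 2)) * (deriv (b 0) t ^ 2 + deriv (b 1) t ^ 2) := by
        refine mul_le_mul_of_nonneg_right ?_ (by positivity)
        linarith [hb t ht]
      nlinarith
    nlinarith [h.sum_deriv_sq_le ht, hρpos t ht]

end Riemannian

theorem immersesNonInjectively_euclidean (hI : IsOpen I) (hI' : I.OrdConnected)
    (hne : I.Nonempty) (hρ : ContDiffOn ℝ ∞ ρ I) (hη : ContDiffOn ℝ ∞ η I)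
    (hρpos : ∀ t ∈ I, 0 < ρ t) :
    ImmersesNonInjectively I ρ η 0 (Set.univ : Set (Fin 5 → ℝ)) := by
  obtain ⟨b, N, h⟩ := exists_isAmplitudePair hI hρ hη hρpos one_pos
  obtain ⟨A, -, hf⟩ := exists_flat_oscillation hI hI' hne hρ hρpos h isQuadricCurve_unit_circle
  refine ⟨_, hf, not_injOn_of_periodic hne Real.two_pi_pos.ne' fun t => ?_⟩
  rw [oscillation_circle_periodic]

theorem immersesNonInjectively_hyperbolicSpace (hI : IsOpen I) (hI' : I.OrdConnected)
    (hne : I.Nonempty) (hρ : ContDiffOn ℝ ∞ ρ I) (hη : ContDiffOn ℝ ∞ η I)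
    (hρpos : ∀ t ∈ I, 0 < ρ t) (hc : 0 < c) :
    ImmersesNonInjectively I ρ η 1 (hyperbolicSpace 5 c) := by
  obtain ⟨b, N, h⟩ := exists_isAmplitudePair hI hρ hη hρpos one_pos
  obtain ⟨r, δ, hr, -, ⟨hδ, -⟩, hf⟩ :=
    exists_hyperbolic_oscillation hI hI' hne hρ hρpos hc h isQuadricCurve_unit_circle
  refine ⟨_, ⟨hf.smooth, fun p hp => ⟨hf.mapsTo hp, mul_pos (hr _ hp.1) (hδ _)⟩, hf.isometric⟩,
    not_injOn_of_periodic hne Real.two_pi_pos.ne' fun t => ?_⟩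
  rw [oscillation_circle_periodic]

theorem immersesNonInjectively_sphere (hI : IsOpen I) (hI' : I.OrdConnected)
    (hne : I.Nonempty) (hρ : ContDiffOn ℝ ∞ ρ I) (hη : ContDiffOn ℝ ∞ η I)
    (hρpos : ∀ t ∈ I, 0 < ρ t) (hc : 0 < c) :
    ImmersesNonInjectively I ρ η 0 (sphere 5 c) := by
  obtain ⟨κ, hκ0, hκ⟩ : ∃ κ : ℝ, 0 < κ ∧ 4 * κ ^ 2 = 1 / c :=
    ⟨√(1 / c) / 2, by positivity, by rw [div_pow, Real.sq_sqrt (by positivity)]; ring⟩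
  obtain ⟨b, N, h⟩ := exists_isAmplitudePair hI hρ hη hρpos hκ0
  obtain ⟨r, δ, -, -, -, hf⟩ := exists_spherical_oscillation (j := 2) hI hρ hρpos hκ hκ0 h
    isQuadricCurve_unit_circle fun w hw _ => exists_circle hI hI' hne hw
  refine ⟨_, hf, not_injOn_of_periodic hne Real.two_pi_pos.ne' fun t => ?_⟩
  rw [oscillation_circle_periodic]

theorem embeds_euclidean (hI : IsOpen I) (hI' : I.OrdConnected)
    (hne : I.Nonempty) (hρ : ContDiffOn ℝ ∞ ρ I) (hη : ContDiffOn ℝ ∞ η I)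
    (hρpos : ∀ t ∈ I, 0 < ρ t) (hηpos : ∀ t ∈ I, 0 < η t) :
    Embeds I ρ η 0 (Set.univ : Set (Fin 9 → ℝ)) := by
  obtain ⟨b, N, h⟩ := exists_isAmplitudePair hI hρ hη hρpos one_pos
  obtain ⟨γ, hγ, hγe⟩ := exists_unit_spiral
  obtain ⟨A, hA, hf⟩ := exists_flat_oscillation hI hI' hne hρ hρpos h hγ
  exact ⟨_, hf.isIsometricEmbedding
    (embedsOn_append_curve hA (recoversSnd_oscillation hI h hηpos hγe)).1⟩

theorem embeds_hyperbolicSpace (hI : IsOpen I) (hI' : I.OrdConnected)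
    (hne : I.Nonempty) (hρ : ContDiffOn ℝ ∞ ρ I) (hη : ContDiffOn ℝ ∞ η I)
    (hρpos : ∀ t ∈ I, 0 < ρ t) (hηpos : ∀ t ∈ I, 0 < η t) (hc : 0 < c) :
    Embeds I ρ η 1 (hyperbolicSpace 9 c) := by
  obtain ⟨b, N, h⟩ := exists_isAmplitudePair hI hρ hη hρpos one_pos
  obtain ⟨γ, hγ, hγe⟩ := exists_unit_spiral
  obtain ⟨r, δ, hr, hrq, ⟨hδ, hδe⟩, hf⟩ :=
    exists_hyperbolic_oscillation hI hI' hne hρ hρpos hc h hγ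
  have hf' : IsIsometricImmersion I ρ η (fun _ => semiInner 1) (hyperbolicSpace 9 c) _ :=
    ⟨hf.smooth, fun p hp => ⟨hf.mapsTo hp, mul_pos (hr _ hp.1) (hδ _)⟩, hf.isometric⟩
  exact ⟨_, hf'.isIsometricEmbedding
    (embedsOn_append_smul hδe hr hrq (recoversSnd_oscillation hI h hηpos hγe)).1⟩

theorem embeds_sphere (hI : IsOpen I) (hI' : I.OrdConnected)
    (hne : I.Nonempty) (hρ : ContDiffOn ℝ ∞ ρ I) (hη : ContDiffOn ℝ ∞ η I)
    (hρpos : ∀ t ∈ I, 0 < ρ t) (hηpos : ∀ t ∈ I, 0 < η t) (hc : 0 < c) :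
    Embeds I ρ η 0 (sphere 11 c) := by
  obtain ⟨κ, hκ0, hκ⟩ : ∃ κ : ℝ, 0 < κ ∧ 4 * κ ^ 2 = 1 / c :=
    ⟨√(1 / c) / 2, by positivity, by rw [div_pow, Real.sq_sqrt (by positivity)]; ring⟩
  obtain ⟨b, N, h⟩ := exists_isAmplitudePair hI hρ hη hρpos hκ0
  obtain ⟨γ, hγ, hγe⟩ := exists_unit_spiral
  obtain ⟨r, δ, hr, hrq, hδe, hf⟩ := exists_spherical_oscillation hI hρ hρpos hκ hκ0 h hγ
    fun w hw hw0 => exists_spiral hI hI' hne hw hw0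
  exact ⟨_, hf.isIsometricEmbedding
    (embedsOn_append_smul hδe hr hrq (recoversSnd_oscillation hI h hηpos hγe)).1⟩

end Targets

/-! ### Lorentzian targets -/

section Lorentzian

variable {I : Set ℝ} {ρ η : ℝ → ℝ} {c : ℝ}

/-- The hyperbolic rotation `(t, x) ↦ η(t) (cosh x, sinh x)` in `ℝ²_1`, whose metric
`-η'² dt² + η² dx²` needs no correction in the direction of `x`. -/
noncomputable def boost (η : ℝ → ℝ) : ℝ × ℝ → Fin 2 → ℝ :=
  spin η (fun _ => 1) fun x => ![Real.cosh x, Real.sinh x]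

theorem hasMetric_boost (hI : IsOpen I) (hη : ContDiffOn ℝ ∞ η I) :
    HasMetric I 1 (boost η) (fun t => -deriv η t ^ 2) fun t => η t ^ 2 :=
  (hasMetric_spin hI isQuadricCurve_unit_hyperbola hη
    fun _ _ => Or.inl (Eventually.of_forall fun _ => rfl)).congr (fun t _ => by ring)
      fun t _ => by ring

theorem semiInner_boost (p : ℝ × ℝ) : semiInner 1 (boost η p) (boost η p) = -η p.1 ^ 2 := by
  rw [boost, semiInner_spin isQuadricCurve_unit_hyperbola]
  ring

theorem recoversSnd_boost (hI : IsOpen I) (hη : ContDiffOn ℝ ∞ η I) (hηpos : ∀ t ∈ I, 0 < η t) :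
    ∀ p ∈ I ×ˢ (Set.univ : Set ℝ), RecoversSnd I (boost η) p := fun _ hp =>
  recoversSnd_spin hI embedsOn_unit_hyperbola hη.continuousOn hp.1
    (Or.inl (Eventually.of_forall fun _ => rfl)) (hηpos _ hp.1).ne' one_ne_zero

theorem exists_minkowski_embedding (hI : IsOpen I) (hI' : I.OrdConnected) (hne : I.Nonempty)
    (hρ : ContDiffOn ℝ ∞ ρ I) (hη : ContDiffOn ℝ ∞ η I) (hρpos : ∀ t ∈ I, 0 < ρ t)
    (hηpos : ∀ t ∈ I, 0 < η t) :
    ∃ f : ℝ × ℝ → Fin 3 → ℝ, HasMetric I 1 f (fun t => ρ t ^ 2) (fun t => η t ^ 2) ∧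
      EmbedsOn f (I ×ˢ Set.univ) := by
  obtain ⟨A, hA, hAe⟩ := exists_flat_coordinate (e := fun t => -deriv η t ^ 2) hI hI' hne hρ
    ((hη.deriv_of_isOpen hI (by simp)).pow 2).neg
    fun t ht => by nlinarith [sq_nonneg (deriv η t), hρpos t ht]
  exact ⟨_, ((hasMetric_boost hI hη).append hI one_le_two hA).congr (fun t _ => by ring)
    fun t _ => by ring, (embedsOn_append_curve hAe (recoversSnd_boost hI hη hηpos)).2⟩

/-- The hyperbolic rotation, completed to the quadric `⟨x, x⟩ = 1 / c` of `ℝ^{2+k}_1` by a curve in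
`ℝᵏ` of radius `√(1 / c + η²)`. -/
theorem exists_deSitter_immersion {k : ℕ} {P : (ℝ → Fin k → ℝ) → Prop} (hI : IsOpen I)
    (hρ : ContDiffOn ℝ ∞ ρ I) (hη : ContDiffOn ℝ ∞ η I) (hρpos : ∀ t ∈ I, 0 < ρ t) (hc : 0 < c)
    (hcurve : ∀ w : ℝ → ℝ, ContDiffOn ℝ ∞ w I → (∀ t ∈ I, 0 < w t) →
      ∃ γ : ℝ → Fin k → ℝ, IsQuadricCurve I 0 1 w γ ∧ P γ) :
    ∃ (r : ℝ → ℝ) (γ : ℝ → Fin k → ℝ), (∀ t ∈ I, 0 < r t) ∧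
      (∀ p ∈ I ×ˢ (Set.univ : Set ℝ),
        r p.1 ^ 2 = 1 * (1 / c - semiInner 1 (boost η p) (boost η p))) ∧ P γ ∧
      IsIsometricImmersion I ρ η (fun _ => semiInner 1) {x | semiInner 1 x x = 1 / c}
        (fun p => Fin.append (boost η p) (r p.1 • γ p.1)) := by
  have hc' : 0 < 1 / c := one_div_pos.2 hc
  refine exists_completion_right (q := fun t => -η t ^ 2) (e := fun t => -deriv η t ^ 2) hI hρ
    (hη.pow 2).neg ((hη.deriv_of_isOpen hI (by simp)).pow 2).neg
    (fun t _ => by nlinarith [sq_nonneg (η t)]) (fun t ht => ?_) hcurve one_le_two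
    (hasMetric_boost hI hη) semiInner_boost
  have hd := ((hη.contDiffAt (hI.mem_nhds ht)).differentiableAt (by simp)).hasDerivAt
  have h1 : 0 < 1 / c - -η t ^ 2 := by nlinarith [sq_nonneg (η t)]
  have h2 : deriv (fun t => -η t ^ 2) t ^ 2 / (4 * (1 / c - -η t ^ 2)) ≤ deriv η t ^ 2 := by
    rw [(hd.fun_pow 2).fun_neg.deriv, div_le_iff₀ (by linarith)]
    simp only [Nat.cast_ofNat, Nat.add_one_sub_one, pow_one]
    nlinarith [mul_nonneg hc'.le (sq_nonneg (deriv η t))]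
  nlinarith [hρpos t ht]

theorem immerses_deSitter (hI : IsOpen I) (hI' : I.OrdConnected) (hne : I.Nonempty)
    (hρ : ContDiffOn ℝ ∞ ρ I) (hη : ContDiffOn ℝ ∞ η I) (hρpos : ∀ t ∈ I, 0 < ρ t) (hc : 0 < c) :
    Immerses I ρ η 1 (deSitter 3 c) := by
  obtain ⟨r, γ, -, -, -, hf⟩ := exists_deSitter_immersion (k := 2) hI hρ hη hρpos hc
    fun w hw _ => exists_circle hI hI' hne hw
  exact ⟨_, hf⟩

theorem embeds_deSitter (hI : IsOpen I) (hI' : I.OrdConnected) (hne : I.Nonempty)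
    (hρ : ContDiffOn ℝ ∞ ρ I) (hη : ContDiffOn ℝ ∞ η I) (hρpos : ∀ t ∈ I, 0 < ρ t)
    (hηpos : ∀ t ∈ I, 0 < η t) (hc : 0 < c) : Embeds I ρ η 1 (deSitter 5 c) := by
  obtain ⟨r, γ, hr, hrq, hγe, hf⟩ := exists_deSitter_immersion hI hρ hη hρpos hc
    fun w hw hw0 => exists_spiral hI hI' hne hw hw0
  exact ⟨_, hf.isIsometricEmbedding
    (embedsOn_append_smul hγe hr hrq (recoversSnd_boost hI hη hηpos)).2⟩

/-- If `η ≥ δ > 0`, the circles of radius `s η` with `s δ > 1 / √c` are too large for the sphere of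
curvature `c`, and are completed to de Sitter space by a hyperbola. -/
theorem immersesNonInjectively_deSitter (hI : IsOpen I) (hI' : I.OrdConnected)
    (hne : I.Nonempty) (hρ : ContDiffOn ℝ ∞ ρ I) (hη : ContDiffOn ℝ ∞ η I)
    (hρpos : ∀ t ∈ I, 0 < ρ t) (hc : 0 < c) (hδ : ∃ δ > 0, ∀ t ∈ I, δ ≤ η t) :
    ImmersesNonInjectively I ρ η 1 (deSitter 3 c) := by
  obtain ⟨δ, hδ0, hδ⟩ := hδ
  have hc' : 0 < 1 / c := one_div_pos.2 hc
  obtain ⟨s, hs0, hs⟩ : ∃ s : ℝ, 0 < s ∧ 1 / c < (s * δ) ^ 2 := by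
    refine ⟨(√(1 / c) + 1) / δ, by positivity, ?_⟩
    rw [div_mul_cancel₀ _ hδ0.ne']
    nlinarith [Real.sq_sqrt hc'.le, Real.sqrt_nonneg (1 / c)]
  set b : ℝ → ℝ := fun t => s * η t with hb
  have hbs : ContDiffOn ℝ ∞ b I := contDiffOn_const.mul hη
  have hb's : ContDiffOn ℝ ∞ (deriv b) I := hbs.deriv_of_isOpen hI (by simp)
  have hbc : ∀ t ∈ I, 1 / c < b t ^ 2 := fun t ht =>
    hs.trans_le (pow_le_pow_left₀ (by positivity) (mul_le_mul_of_nonneg_left (hδ t ht) hs0.le) 2)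
  set Y := spin b (fun _ => 1 / s) fun x => ![Real.cos x, Real.sin x] with hYdef
  have hY : HasMetric I 0 Y (fun t => deriv b t ^ 2) fun t => η t ^ 2 :=
    (hasMetric_spin hI isQuadricCurve_unit_circle hbs
      fun _ _ => Or.inl (Eventually.of_forall fun _ => rfl)).congr (fun t _ => by ring)
      fun t _ => by simp only [hb]; field_simp
  have hlt : ∀ t ∈ I,
      deriv (fun t => b t ^ 2) t ^ 2 / (4 * (1 / c - b t ^ 2)) + deriv b t ^ 2 < ρ t ^ 2 := by
    intro t ht
    have hd := ((hbs.contDiffAt (hI.mem_nhds ht)).differentiableAt (by simp)).hasDerivAt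
    have h1 : 0 < b t ^ 2 - 1 / c := by linarith [hbc t ht]
    have h2 : deriv (fun t => b t ^ 2) t ^ 2 / (4 * (1 / c - b t ^ 2)) ≤ -deriv b t ^ 2 := by
      rw [(hd.fun_pow 2).deriv, div_le_iff_of_neg (by linarith)]
      simp only [Nat.cast_ofNat, Nat.add_one_sub_one, pow_one]
      nlinarith [mul_nonneg hc'.le (sq_nonneg (deriv b t))]
    nlinarith [hρpos t ht]
  obtain ⟨r, γ, -, -, -, hf⟩ := exists_completion_left (q := fun t => b t ^ 2) (K := 1 / c) hI hρ
    (Or.inr rfl) (hbs.pow 2) (hb's.pow 2) (fun t ht => by linarith [hbc t ht]) hlt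
    (fun w hw hw0 => exists_hyperbola hI hI' hne hw hw0) one_le_two hY
    fun p => by rw [hYdef, semiInner_spin isQuadricCurve_unit_circle, one_mul]
  refine ⟨_, hf, not_injOn_of_periodic hne (L := 2 * Real.pi * s) (by positivity) fun t => ?_⟩
  have h1 : s⁻¹ * (2 * Real.pi * s) = 2 * Real.pi := by field_simp
  simp [hYdef, spin, h1]

/-! ### The horosphere in anti-de Sitter space -/

/-- The coordinate `x₀` of `horosphere c y`. -/
noncomputable def horosphereHeight (c : ℝ) (y : Fin 3 → ℝ) : ℝ :=
  (1 + 1 / c + semiInner 1 y y) / 2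

/-- The isometric embedding of `ℝ³_1` onto the part `x₀ + x₄ = 1` of the quadric
`⟨x, x⟩ = -1 / c` of `ℝ⁵_2`. -/
noncomputable def horosphere (c : ℝ) (y : Fin 3 → ℝ) : Fin 5 → ℝ :=
  ![horosphereHeight c y, y 0, y 1, y 2, 1 - horosphereHeight c y]

theorem contDiff_horosphereHeight : ContDiff ℝ ∞ (horosphereHeight c) := by
  unfold horosphereHeight
  simp only [semiInner, Fin.sum_univ_succ]
  simp
  fun_prop

theorem contDiff_horosphere : ContDiff ℝ ∞ (horosphere c) := by
  have h := contDiff_horosphereHeight (c := c)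
  refine contDiff_pi.2 fun i => ?_
  fin_cases i
  · exact h
  · exact contDiff_apply ℝ ℝ 0
  · exact contDiff_apply ℝ ℝ 1
  · exact contDiff_apply ℝ ℝ 2
  · exact contDiff_const.sub h

theorem semiInner_horosphere (y : Fin 3 → ℝ) :
    semiInner 2 (horosphere c y) (horosphere c y) = -(1 / c) := by
  have h : horosphereHeight c y = (1 + 1 / c + (-(y 0 * y 0) + y 1 * y 1 + y 2 * y 2)) / 2 := by
    simp [horosphereHeight, semiInner, Fin.sum_univ_three]
  simp [horosphere, semiInner, Fin.sum_univ_five, h]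
  ring

/-- The differentials of `x₀` and `x₄ = 1 - x₀` are opposite, and their contributions cancel. -/
theorem semiInner_fderiv_horosphere (y v w : Fin 3 → ℝ) :
    semiInner 2 (fderiv ℝ (horosphere c) y v) (fderiv ℝ (horosphere c) y w) = semiInner 1 v w := by
  have h := ((contDiff_horosphereHeight (c := c)).differentiable (by simp) y).hasFDerivAt
  set L := fderiv ℝ (horosphereHeight c) y
  have h1 : HasFDerivAt (horosphere c) (ContinuousLinearMap.pi
      ![L, ContinuousLinearMap.proj 0, ContinuousLinearMap.proj 1, ContinuousLinearMap.proj 2,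
        -L]) y := by
    refine hasFDerivAt_pi.2 fun i => ?_
    fin_cases i
    · exact h
    · exact hasFDerivAt_apply 0 y
    · exact hasFDerivAt_apply 1 y
    · exact hasFDerivAt_apply 2 y
    · exact h.const_sub 1
  rw [h1.fderiv]
  simp [semiInner, Fin.sum_univ_three, Fin.sum_univ_five]
  ring

theorem exists_horosphere_embedding (hI : IsOpen I) (hI' : I.OrdConnected) (hne : I.Nonempty)
    (hρ : ContDiffOn ℝ ∞ ρ I) (hη : ContDiffOn ℝ ∞ η I) (hρpos : ∀ t ∈ I, 0 < ρ t)
    (hηpos : ∀ t ∈ I, 0 < η t) (c : ℝ) :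
    ∃ f : ℝ × ℝ → Fin 3 → ℝ, ContDiffOn ℝ ∞ f (I ×ˢ Set.univ) ∧
      IsIsometricEmbedding I ρ η (fun _ => semiInner 2) (pseudoHyperbolic 4 1 c)
        (fun p => horosphere c (f p)) := by
  obtain ⟨f, hf, hfe⟩ := exists_minkowski_embedding hI hI' hne hρ hη hρpos hηpos
  have him : IsIsometricImmersion I ρ η (fun _ => semiInner 2) (pseudoHyperbolic 4 1 c)
      (fun p => horosphere c (f p)) := by
    refine ⟨contDiff_horosphere.comp_contDiffOn hf.smooth, fun p _ => semiInner_horosphere _,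
      fun p hp v w => ?_⟩
    have h1 := (hf.smooth.contDiffAt ((isOpen_strip hI).mem_nhds hp)).differentiableAt (by simp)
    have h2 : DifferentiableAt ℝ (horosphere c) (f p) :=
      contDiff_horosphere.differentiable (by simp) _
    have h3 : fderiv ℝ (fun p => horosphere c (f p)) p =
        (fderiv ℝ (horosphere c) (f p)).comp (fderiv ℝ f p) := fderiv_fun_comp p h2 h1
    simp only [h3, ContinuousLinearMap.comp_apply, semiInner_fderiv_horosphere, hf.metric p hp]
  refine ⟨f, hf.smooth, him.isIsometricEmbedding ?_⟩
  have hproj : Continuous fun x : Fin 5 → ℝ => ![x 1, x 2, x 3] := by fun_prop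
  refine EmbedsOn.of_comp hproj ?_
  convert hfe using 2 with p
  ext i
  fin_cases i <;> rfl

/-- Where the time coordinate `x₁ = y₀` of the horosphere vanishes, `x₀` is positive. Hence
`(x₀, x₁)` avoids the negative real axis and has a smooth argument. -/
theorem horosphere_mem_slitPlane (hc : 0 < c) (y : Fin 3 → ℝ) :
    (⟨horosphereHeight c y, y 0⟩ : ℂ) ∈ Complex.slitPlane := by
  rw [Complex.mem_slitPlane_iff]
  by_cases h : y 0 = 0
  · left
    have hc' : 0 < 1 / c := one_div_pos.2 hc
    have h1 : horosphereHeight c y = (1 + 1 / c + (y 1 * y 1 + y 2 * y 2)) / 2 := by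
      simp [horosphereHeight, semiInner, Fin.sum_univ_three, h]
    rw [h1]
    nlinarith [mul_self_nonneg (y 1), mul_self_nonneg (y 2)]
  · exact Or.inr h

/-- The lift of the horosphere to the universal covering of the quadric. -/
noncomputable def horosphereLift (c : ℝ) (y : Fin 3 → ℝ) : ℝ × (Fin 3 → ℝ) :=
  (Complex.arg ⟨horosphereHeight c y, y 0⟩, ![y 1, y 2, 1 - horosphereHeight c y])

theorem adsCover_horosphereLift (y : Fin 3 → ℝ) :
    adsCover 3 c (horosphereLift c y) = horosphere c y := by
  have h := semiInner_horosphere (c := c) y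
  have hr : √(1 / c + ∑ i, (horosphereLift c y).2 i ^ 2) =
      ‖(⟨horosphereHeight c y, y 0⟩ : ℂ)‖ := by
    rw [Complex.norm_def, Complex.normSq_mk]
    congr 1
    simp [horosphere, semiInner, Fin.sum_univ_five] at h
    simp [horosphereLift, Fin.sum_univ_three]
    linarith
  have h1 := Complex.norm_mul_cos_arg (⟨horosphereHeight c y, y 0⟩ : ℂ)
  have h2 := Complex.norm_mul_sin_arg (⟨horosphereHeight c y, y 0⟩ : ℂ)
  rw [adsCover, hr]
  simp only [horosphereLift, h1, h2]
  rfl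

theorem contDiff_horosphereLift (hc : 0 < c) : ContDiff ℝ ∞ (horosphereLift c) := by
  have hh := contDiff_horosphereHeight (c := c)
  refine ContDiff.prodMk ?_ ?_
  · have hz : ContDiff ℝ ∞ fun y : Fin 3 → ℝ => (⟨horosphereHeight c y, y 0⟩ : ℂ) :=
      (Complex.equivRealProdCLM.symm.contDiff).comp (hh.prodMk (contDiff_apply ℝ ℝ 0))
    have hlog : ContDiff ℝ ∞ fun y : Fin 3 → ℝ =>
        Complex.log (⟨horosphereHeight c y, y 0⟩ : ℂ) :=
      contDiff_iff_contDiffAt.2 fun y =>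
        ContDiffAt.comp (g := Complex.log) y
          ((Complex.contDiffAt_log (horosphere_mem_slitPlane hc y)).restrict_scalars ℝ)
          hz.contDiffAt
    simpa only [Function.comp_def, Complex.imCLM_apply, Complex.log_im]
      using Complex.imCLM.contDiff.comp hlog
  · refine contDiff_pi.2 fun i => ?_
    fin_cases i
    · exact contDiff_apply ℝ ℝ 1
    · exact contDiff_apply ℝ ℝ 2
    · exact contDiff_const.sub hh

theorem contDiff_adsCover {m : ℕ} (hc : 0 < c) : ContDiff ℝ ∞ (adsCover m c) := by
  have hz : ∀ i, ContDiff ℝ ∞ fun z : ℝ × (Fin m → ℝ) => z.2 i := fun i =>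
    (contDiff_apply ℝ ℝ i).comp contDiff_snd
  have hr : ContDiff ℝ ∞ fun z : ℝ × (Fin m → ℝ) => √(1 / c + ∑ i, z.2 i ^ 2) := by
    refine (contDiff_const.add (ContDiff.sum fun i _ => (hz i).pow 2)).sqrt fun z => ?_
    positivity
  rw [← contDiffOn_univ] at *
  exact contDiffOn_vecCons (hr.mul (Real.contDiff_cos.comp_contDiffOn contDiffOn_fst))
    (contDiffOn_vecCons (hr.mul (Real.contDiff_sin.comp_contDiffOn contDiffOn_fst))
      contDiffOn_snd)

theorem embedsInAdS (hI : IsOpen I) (hI' : I.OrdConnected) (hne : I.Nonempty)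
    (hρ : ContDiffOn ℝ ∞ ρ I) (hη : ContDiffOn ℝ ∞ η I) (hρpos : ∀ t ∈ I, 0 < ρ t)
    (hηpos : ∀ t ∈ I, 0 < η t) (hc : 0 < c) : EmbedsInAdS I ρ η 3 c := by
  obtain ⟨f, hf, hfe⟩ := exists_horosphere_embedding hI hI' hne hρ hη hρpos hηpos c
  have hF : ContDiffOn ℝ ∞ (fun p => horosphereLift c (f p)) (I ×ˢ Set.univ) :=
    (contDiff_horosphereLift hc).comp_contDiffOn hf
  have hcov : (fun p => adsCover 3 c (horosphereLift c (f p))) = fun p => horosphere c (f p) :=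
    funext fun p => adsCover_horosphereLift (f p)
  refine ⟨fun p => horosphereLift c (f p),
    ⟨⟨hF, Set.mapsTo_univ _ _, fun p hp v w => ?_⟩, ?_⟩⟩
  · have h1 := (hF.contDiffAt ((isOpen_strip hI).mem_nhds hp)).differentiableAt (by simp)
    have h2 : DifferentiableAt ℝ (adsCover 3 c) (horosphereLift c (f p)) :=
      (contDiff_adsCover hc).differentiable (by simp) _
    have h3 := fderiv_fun_comp p h2 h1
    rw [hcov] at h3
    rw [← hfe.isometric p hp v w, h3]
    rfl
  · refine IsEmbedding.of_comp hF.continuousOn.domRestrict (contDiff_adsCover hc).continuous ?_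
    convert hfe.isEmbedding using 1
    exact funext fun p => adsCover_horosphereLift (f p)

end Lorentzian

end WarpedSurface

theorem mainTheorem2 (I : Set ℝ) (hI : IsOpen I) (hI' : I.OrdConnected) (hne : I.Nonempty)
    (ρ η : ℝ → ℝ) (hρ : ContDiffOn ℝ ∞ ρ I) (hη : ContDiffOn ℝ ∞ η I)
    (hρpos : ∀ t ∈ I, 0 < ρ t) (hηpos : ∀ t ∈ I, 0 < η t) (c : ℝ) (hc : 0 < c) :
    (WarpedSurface.ImmersesNonInjectively I ρ η 0 (Set.univ : Set (Fin 5 → ℝ)) ∧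
      WarpedSurface.ImmersesNonInjectively I ρ η 1 (WarpedSurface.hyperbolicSpace 5 c) ∧
      WarpedSurface.ImmersesNonInjectively I ρ η 0 (WarpedSurface.sphere 5 c) ∧
      WarpedSurface.Immerses I ρ η 1 (WarpedSurface.deSitter 3 c) ∧
      ((∃ δ > 0, ∀ t ∈ I, δ ≤ η t) →
        WarpedSurface.ImmersesNonInjectively I ρ η 1 (WarpedSurface.deSitter 3 c))) ∧
    (WarpedSurface.Embeds I ρ η 0 (Set.univ : Set (Fin 9 → ℝ)) ∧
      WarpedSurface.Embeds I ρ η 1 (WarpedSurface.hyperbolicSpace 9 c) ∧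
      WarpedSurface.Embeds I ρ η 0 (WarpedSurface.sphere 11 c) ∧
      WarpedSurface.Embeds I ρ η 1 (Set.univ : Set (Fin 3 → ℝ)) ∧
      WarpedSurface.Embeds I ρ η 2 (WarpedSurface.pseudoHyperbolic 4 1 c) ∧
      WarpedSurface.EmbedsInAdS I ρ η 3 c ∧
      WarpedSurface.Embeds I ρ η 1 (WarpedSurface.deSitter 5 c)) := by
  exact ⟨⟨WarpedSurface.immersesNonInjectively_euclidean hI hI' hne hρ hη hρpos,
    WarpedSurface.immersesNonInjectively_hyperbolicSpace hI hI' hne hρ hη hρpos hc,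
    WarpedSurface.immersesNonInjectively_sphere hI hI' hne hρ hη hρpos hc,
    WarpedSurface.immerses_deSitter hI hI' hne hρ hη hρpos hc,
    WarpedSurface.immersesNonInjectively_deSitter hI hI' hne hρ hη hρpos hc⟩,
    WarpedSurface.embeds_euclidean hI hI' hne hρ hη hρpos hηpos,
    WarpedSurface.embeds_hyperbolicSpace hI hI' hne hρ hη hρpos hηpos hc,
    WarpedSurface.embeds_sphere hI hI' hne hρ hη hρpos hηpos hc,
    (WarpedSurface.exists_minkowski_embedding hI hI' hne hρ hη hρpos hηpos).imp fun _ hf =>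
      (hf.1.isIsometricImmersion (Set.mapsTo_univ _ _)).isIsometricEmbedding hf.2,
    (WarpedSurface.exists_horosphere_embedding hI hI' hne hρ hη hρpos hηpos c).imp' _
      fun _ hf => hf.2,
    WarpedSurface.embedsInAdS hI hI' hne hρ hη hρpos hηpos hc,
    WarpedSurface.embeds_deSitter hI hI' hne hρ hη hρpos hηpos hc⟩
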